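/- Let $G$ be a locally compact second countable (Hausdorff) group, with a left Haar measure $\lambda$. Call $G$ amenable if there is a left-invariant mean on $L^\infty(G,\lambda)$. For a probability measure preserving action $G\curvearrowright (X,\mu)$ let $(\pi(g)f)(x)=f(g^{-1}x)$ be the Koopman representation on $L^2(X,\mu)$ and let $L^2_0(X,\mu)=\{f\in L^2(X,\mu):\int f\,d\mu=0\}$ (real or complex scalars). The action has spectral gap if there is no sequence of unit vectors $f_n\in L^2_0(X,\mu)$ with $\lim_{n\to\infty}\|\pi(g)f_n-f_n\|_2=0$ for every $g\in G$. (1) Suppose that $G$ is nondiscrete. Let $\mathbb{M}$ be the space of locally finite subsets $\omega$ of $G$, with the $\sigma$-algebra generated by the counting functions $N_U(\omega)=|\omega\cap U|$, $U\subseteq G$ Borel, and with $G$ acting by left translation. Let $t>0$ and let $\mathcal{P}_t$ be the law on $\mathbb{M}$ of the Poisson point process on $G$ of intensity $t$: for every Borel $U$, $N_U$ is Poisson distributed with parameter $t\lambda(U)\in[0,\infty]$ (with $N_U=\infty$ almost surely if the parameter is $\infty$), and $N_U$, $N_V$ are independent for disjoint Borel $U,V$. Then $G$ is nonamenable if and only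 if the action $G\curvearrowright(\mathbb{M},\mathcal{P}_t)$ has spectral gap. (2) Suppose that $G$ is discrete, and let $0<p<1$. Then $G$ is nonamenable if and only if the Bernoulli shift $G\curvearrowright(\{0,1\}^G,\mathrm{Ber}(p)^{\otimes G})$ has spectral gap. -/

import Mathlib

open MeasureTheory ProbabilityTheory Filter Topology
open scoped ENNReal NNReal Pointwise

noncomputable section

/-! ### Amenability -/

/-- A locally compact group is amenable if there is a left-invariant mean on `L^∞(G)`: a positive
linear functional `m` with `m 1 = 1` and `m (f (g ·)) = m f` for all `g ∈ G`.
(`DomMulAct.mk g • f` is Mathlib's name for the class of `x ↦ f (g * x)`.) -/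
def IsAmenableGroup (G : Type*) [Group G] [TopologicalSpace G] [IsTopologicalGroup G]
    [LocallyCompactSpace G] [MeasurableSpace G] [BorelSpace G] : Prop :=
  ∃ m : Lp ℝ ∞ (Measure.haar : Measure G) →ₗ[ℝ] ℝ,
    (∀ f, 0 ≤ f → 0 ≤ m f) ∧
    m ((memLp_top_const (1 : ℝ)).toLp (fun _ : G => (1 : ℝ))) = 1 ∧
    ∀ (g : G) (f : Lp ℝ ∞ (Measure.haar : Measure G)), m (DomMulAct.mk g • f) = m f

/-! ### Koopman representation and spectral gap -/

/-- The Koopman operator `(π(g) f)(x) = f (g⁻¹ x)`. -/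
def koopman {G X E : Type*} [Group G] [MulAction G X] (g : G) (f : X → E) : X → E :=
  fun x => f (g⁻¹ • x)

/-- An almost invariant sequence in `L²₀(X, μ; 𝕜)` for an action of `G` on `(X, μ)`: unit vectors
`f n` of mean zero with `‖π(g) (f n) - f n‖₂ → 0` for every `g`. -/
structure IsAlmostInvariantSeq (𝕜 G : Type*) {X : Type*} [RCLike 𝕜] [Group G] [MulAction G X]
    [MeasurableSpace X] (μ : Measure X) (f : ℕ → X → 𝕜) : Prop where
  memLp : ∀ n, MemLp (f n) 2 μ
  mean_zero : ∀ n, ∫ x, f n x ∂μ = 0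
  norm_eq_one : ∀ n, eLpNorm (f n) 2 μ = 1
  tendsto : ∀ g : G, Tendsto (fun n => eLpNorm (koopman g (f n) - f n) 2 μ) atTop (𝓝 0)

/-- A probability measure preserving action has spectral gap if `L²₀` contains no almost
invariant sequence. -/
def HasSpectralGap (𝕜 G : Type*) {X : Type*} [RCLike 𝕜] [Group G] [MulAction G X]
    [MeasurableSpace X] (μ : Measure X) : Prop :=
  ¬ ∃ f : ℕ → X → 𝕜, IsAlmostInvariantSeq 𝕜 G μ f

/-! ### Configurations and Poisson point processes -/

/-- The configuration space of `Z`: the locally finite subsets of `Z` (those that meet every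
compact set in a finite set). -/
def Configuration (Z : Type*) [TopologicalSpace Z] : Type _ :=
  {ω : Set Z // ∀ K : Set Z, IsCompact K → (ω ∩ K).Finite}

namespace Configuration

/-- The point counting function `N_U(ω) = |ω ∩ U|`. -/
def count {Z : Type*} [TopologicalSpace Z] (U : Set Z) (ω : Configuration Z) : ℕ∞ :=
  (ω.1 ∩ U).encard

/-- The σ-algebra generated by the point counting functions of Borel sets. -/
instance {Z : Type*} [TopologicalSpace Z] [MeasurableSpace Z] :
    MeasurableSpace (Configuration Z) :=
  ⨆ (U : Set Z) (_ : MeasurableSet U), MeasurableSpace.comap (count U) inferInstance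

/-- The action of a group on its configurations by left translation, `g • ω = {g * x | x ∈ ω}`. -/
instance {G : Type*} [Group G] [TopologicalSpace G] [IsTopologicalGroup G] :
    MulAction G (Configuration G) where
  smul g ω := ⟨g • ω.1, fun K hK => by
    have h : g • ω.1 ∩ K = g • (ω.1 ∩ g⁻¹ • K) := by
      rw [Set.smul_set_inter, smul_inv_smul]
    rw [h]
    exact (ω.2 _ (hK.smul g⁻¹)).smul_set⟩
  one_smul ω := Subtype.ext (one_smul G ω.1)
  mul_smul g h ω := Subtype.ext (mul_smul g h ω.1)

end Configuration

/-- The Poisson distribution with parameter `r ∈ [0, ∞]`, on `{0, 1, 2, …, ∞}`; for `r = ∞` it is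
the point mass at `∞`. -/
def poissonENat (r : ℝ≥0∞) : Measure ℕ∞ :=
  if r = ∞ then Measure.dirac ⊤ else (poissonMeasure r.toNNReal).map (fun k : ℕ => (k : ℕ∞))

/-- `μ` is the law of a Poisson point process on `Z` of intensity `t` with respect to `lam`:
a probability measure on configurations under which the number of points in a Borel set `U` is
Poisson distributed with parameter `t * lam U`, and the numbers of points in two disjoint Borel
sets are independent. -/
structure IsPoissonPointProcess {Z : Type*} [TopologicalSpace Z] [MeasurableSpace Z]
    (lam : Measure Z) (t : ℝ≥0) (μ : Measure (Configuration Z)) : Prop where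
  isProbabilityMeasure : IsProbabilityMeasure μ
  map_count : ∀ U : Set Z, MeasurableSet U →
    μ.map (Configuration.count U) = poissonENat (t * lam U)
  indep : ∀ U V : Set Z, MeasurableSet U → MeasurableSet V → Disjoint U V →
    IndepFun (Configuration.count U) (Configuration.count V) μ

end

/-! Both cases are treated at once, through a random subset of `G` whose void probabilities are `P(ω
∩ U = ∅) = exp(-t λ(U))` and whose void events generate the σ-algebra (`IsVoidProcess`). The Poisson
process is one; so is the Bernoulli shift, since `(1-p)^|U| = exp(-t λ(U))` for `t = -log(1-p) /
λ({1})`.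

Almost invariant vectors give amenability. The vectors `exp(t λ(U)) 1_{ω ∩ U = ∅} - 1` span a dense
subspace of `L²₀` and have inner products `exp(t λ(U ∩ V)) - 1 = ∑_{n ≥ 1} (t λ(U ∩ V))^n / n!`, so
`L²₀` embeds equivariantly in the sum of the symmetric powers of `L²(G)`. The square of a unit
vector there is a probability density on the union of the `G^n`; averaging its `n` marginals on each
`G^n` gives a density `p_f` on `G`, equivariantly in `f`. No Fock space is built: replacing one
factor `λ(U ∩ V)` in each term by `∫_{U ∩ V} F` gives the kernel `spreadKernel` of the form `f ↦ ∫ F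
p_f`. It is positive semidefinite for `F ≥ 0` and is the Gram kernel for `F = 1`, so the form is
bounded by a multiple of `‖F‖_∞` (`abs_kernelForm_spreadKernel_le`). An ultralimit of its values
along almost invariant vectors is an invariant mean (`IsVoidProcess.isAmenableGroup`).

Conversely, an amenable group satisfies Reiter's condition and so has almost invariant unit vectors
in `L²(G)` (`exists_almostInvariant_L2`). Centered point counts have covariance `b λ(U ∩ V)`, so up
to scale they carry an equivariant copy of `L²(G)` into `L²₀`, and the vectors can be transported
(`exists_almostInvariant_of_inner_eq`). -/

/-! ### Invariant functionals on `L¹(G)` -/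

section HaarFunctionals

open Measure DomMulAct

variable {G : Type*} [Group G] [TopologicalSpace G] [IsTopologicalGroup G]
  [LocallyCompactSpace G] [SecondCountableTopology G] [T2Space G]
  [MeasurableSpace G] [BorelSpace G]

open scoped CompactlySupported in
/-- A bounded left-invariant functional on `L¹` of the Haar measure is a multiple of the
integral. -/
theorem exists_eq_mul_integral_of_leftInvariant
    (J : Lp ℝ 1 (haar : Measure G) →L[ℝ] ℝ)
    (hJ : ∀ (h : G) ψ, J (mk h • ψ) = J ψ) :
    ∃ c : ℝ, ∀ ψ : Lp ℝ 1 (haar : Measure G), J ψ = c * ∫ x, ψ x ∂haar := by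
  have hmem (f : C_c(G, ℝ)) : MemLp f 1 (haar : Measure G) :=
    f.continuous.memLp_of_hasCompactSupport f.hasCompactSupport
  have hint (f : C_c(G, ℝ)) : Integrable f (haar : Measure G) := memLp_one_iff_integrable.1 (hmem f)
  let Λ₀ : C_c(G, ℝ) →ₗ[ℝ] ℝ :=
    -- Adding `‖J‖ ∫ f` makes the functional positive, since `J f ≥ -‖J‖ ∫ f` for `f ≥ 0`; it stays
    -- left invariant, so the Riesz measure is a multiple of Haar measure.
    { toFun f := J ((hmem f).toLp f) + ‖J‖ * ∫ x, f x ∂haar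
      map_add' f g := by
        have h1 : (hmem (f + g)).toLp _ = (hmem f).toLp f + (hmem g).toLp g := rfl
        have h2 : ∫ x, (f + g) x ∂haar = ∫ x, f x ∂haar + ∫ x, g x ∂haar :=
          integral_add (hint f) (hint g)
        rw [h1, h2, map_add]; ring
      map_smul' c f := by
        have h1 : (hmem (c • f)).toLp _ = c • (hmem f).toLp f := rfl
        have h2 : ∫ x, (c • f) x ∂haar = c * ∫ x, f x ∂haar := integral_const_mul c f
        rw [h1, h2, map_smul]; simp only [smul_eq_mul, RingHom.id_apply]; ring }
  let Λ : C_c(G, ℝ) →ₚ[ℝ] ℝ := PositiveLinearMap.mk₀ Λ₀ fun f hf => by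
    have h1 : ‖(hmem f).toLp f‖ = ∫ x, f x ∂haar := by
      rw [L1.norm_eq_integral_norm]
      refine integral_congr_ae ?_
      filter_upwards [(hmem f).coeFn_toLp] with x hx
      rw [hx, Real.norm_of_nonneg (hf x)]
    have h2 := J.le_opNorm ((hmem f).toLp f)
    rw [h1, Real.norm_eq_abs] at h2
    change 0 ≤ J ((hmem f).toLp f) + ‖J‖ * ∫ x, f x ∂haar
    linarith [neg_abs_le (J ((hmem f).toLp f))]
  have hΛ (f : C_c(G, ℝ)) : Λ f = J ((hmem f).toLp f) + ‖J‖ * ∫ x, f x ∂haar := rfl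
  let ν := RealRMK.rieszMeasure Λ
  have hν (f : C_c(G, ℝ)) : ∫ x, f x ∂ν = Λ f := RealRMK.integral_rieszMeasure Λ f
  have : ν.IsMulLeftInvariant := by
    refine ⟨fun h => ?_⟩
    have : (map (h * ·) ν).Regular := Regular.map (Homeomorph.mulLeft h)
    refine Measure.ext_of_integral_eq_on_compactlySupported fun f => ?_
    rw [integral_map (f := f) (measurable_const_mul h).aemeasurable
      (by exact f.continuous.aestronglyMeasurable), hν]
    let f' : C_c(G, ℝ) := ⟨⟨fun x => f (h * x), by fun_prop⟩,
      f.hasCompactSupport.comp_homeomorph (Homeomorph.mulLeft h)⟩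
    have h1 : (hmem f').toLp _ = mk h • (hmem f).toLp f := rfl
    have h2 : ∫ x, f' x ∂haar = ∫ x, f x ∂haar := integral_mul_left_eq_self (μ := haar) f h
    change ∫ x, f' x ∂ν = _
    rw [hν, hΛ, hΛ, h1, h2, hJ]
  obtain ⟨c, hc⟩ : ∃ c : ℝ≥0, ν = c • (haar : Measure G) := ⟨_, isMulLeftInvariant_eq_smul ν haar⟩
  have key (f : C_c(G, ℝ)) : J ((hmem f).toLp f) = (c - ‖J‖) * ∫ x, f x ∂haar := by
    have h1 := hν f
    have h2 : ∫ x, f x ∂ν = c * ∫ x, f x ∂haar := by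
      rw [hc, integral_smul_nnreal_measure]; rfl
    rw [hΛ] at h1
    linarith
  refine ⟨c - ‖J‖, fun ψ => ?_⟩
  have hcl : IsClosed {ψ : Lp ℝ 1 (haar : Measure G) | J ψ = (c - ‖J‖) * ∫ x, ψ x ∂haar} :=
    isClosed_eq J.continuous (continuous_const.mul continuous_integral)
  have hd : ψ ∈ closure {ψ : Lp ℝ 1 (haar : Measure G) | J ψ = (c - ‖J‖) * ∫ x, ψ x ∂haar} := by
    rw [EMetric.mem_closure_iff]
    intro ε hε
    obtain ⟨δ, hδ, hδε⟩ := exists_between hε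
    obtain ⟨g, hg, hg', hgc, hgm⟩ :=
      (Lp.memLp ψ).exists_hasCompactSupport_eLpNorm_sub_le (by simp) hδ.ne'
    let f : C_c(G, ℝ) := ⟨⟨g, hgc⟩, hg⟩
    refine ⟨(hmem f).toLp f, ?_, ?_⟩
    · change J _ = _
      rw [key, integral_congr_ae (hmem f).coeFn_toLp]
    · rw [Lp.edist_def]
      refine lt_of_le_of_lt (le_of_eq_of_le (eLpNorm_congr_ae ?_) hg') hδε
      filter_upwards [(hmem f).coeFn_toLp] with x hx
      rw [Pi.sub_apply, Pi.sub_apply, hx]; rfl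
  exact hcl.closure_subset hd

end HaarFunctionals

/-! ### Invariant means and convolution-type integrals -/

section Reiter

open Measure DomMulAct

variable {G : Type*} [Group G] [TopologicalSpace G] [IsTopologicalGroup G]
  [LocallyCompactSpace G] [MeasurableSpace G] [BorelSpace G]

theorem le_mean_of_ae_le {m : Lp ℝ ∞ (haar : Measure G) →ₗ[ℝ] ℝ}
    (hpos : ∀ f, 0 ≤ f → 0 ≤ m f)
    (hone : m ((memLp_top_const (1 : ℝ)).toLp (fun _ : G => (1 : ℝ))) = 1)
    {u : ℝ} {F : Lp ℝ ∞ (haar : Measure G)} (h : ∀ᵐ x ∂haar, u ≤ F x) : u ≤ m F := by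
  have h0 : 0 ≤ F - u • (memLp_top_const (1 : ℝ)).toLp (fun _ : G => (1 : ℝ)) := by
    rw [← Lp.coeFn_nonneg]
    filter_upwards [h, Lp.coeFn_sub F (u • (memLp_top_const (1 : ℝ)).toLp (fun _ : G => (1 : ℝ))),
      Lp.coeFn_smul u ((memLp_top_const (μ := (haar : Measure G)) (1 : ℝ)).toLp
        (fun _ : G => (1 : ℝ))),
      (memLp_top_const (μ := (haar : Measure G)) (1 : ℝ)).coeFn_toLp] with x h1 h2 h3 h4
    rw [h2, Pi.sub_apply, h3, Pi.smul_apply, h4]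
    simpa using h1
  have := hpos _ h0
  rw [map_sub, map_smul, hone] at this
  simpa using this

theorem abs_mean_le {m : Lp ℝ ∞ (haar : Measure G) →ₗ[ℝ] ℝ}
    (hpos : ∀ f, 0 ≤ f → 0 ≤ m f)
    (hone : m ((memLp_top_const (1 : ℝ)).toLp (fun _ : G => (1 : ℝ))) = 1)
    {C : ℝ} {F : Lp ℝ ∞ (haar : Measure G)} (h : ∀ᵐ x ∂haar, |F x| ≤ C) : |m F| ≤ C := by
  refine abs_le.2 ⟨le_mean_of_ae_le hpos hone (h.mono fun x hx => (abs_le.1 hx).1), ?_⟩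
  have : -C ≤ m (-F) := by
    refine le_mean_of_ae_le hpos hone ?_
    filter_upwards [h, Lp.coeFn_neg F] with x hx hx'
    rw [hx', Pi.neg_apply]
    linarith [(abs_le.1 hx).2]
  rw [map_neg] at this
  linarith

/-- The function `g ↦ ∫ ψ(x) w(g⁻¹ x) dx`. -/
noncomputable def translateIntegral (ψ w : G → ℝ) (g : G) : ℝ :=
  ∫ x, ψ x * w (g⁻¹ * x) ∂haar

theorem abs_translateIntegral_le {ψ w : G → ℝ} (hψ : Integrable ψ (haar : Measure G)) {C : ℝ}
    (hC : ∀ x, |w x| ≤ C) (g : G) :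
    |translateIntegral ψ w g| ≤ C * ∫ x, |ψ x| ∂haar := by
  rw [← integral_const_mul, translateIntegral, ← Real.norm_eq_abs]
  refine norm_integral_le_of_norm_le (hψ.abs.const_mul C) (ae_of_all _ fun x => ?_)
  rw [norm_mul, Real.norm_eq_abs, Real.norm_eq_abs, mul_comm]
  exact mul_le_mul_of_nonneg_right (hC _) (abs_nonneg _)

theorem continuous_translateIntegral [SecondCountableTopology G] {ψ w : G → ℝ}
    (hψ : Integrable ψ (haar : Measure G))
    (hw : Continuous w) {C : ℝ} (hC : ∀ x, |w x| ≤ C) :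
    Continuous (translateIntegral ψ w) := by
  refine continuous_of_dominated (bound := fun x => |ψ x| * C) (fun g => ?_)
    (fun g => ae_of_all _ fun x => ?_) (hψ.abs.mul_const C) (ae_of_all _ fun x => by fun_prop)
  · exact hψ.1.mul (by fun_prop : Continuous fun x => w (g⁻¹ * x)).aestronglyMeasurable
  · rw [norm_mul, Real.norm_eq_abs, Real.norm_eq_abs]
    exact mul_le_mul_of_nonneg_left (hC _) (abs_nonneg _)

theorem memLp_translateIntegral [SecondCountableTopology G] {ψ w : G → ℝ}
    (hψ : Integrable ψ (haar : Measure G))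
    (hw : Continuous w) {C : ℝ} (hC : ∀ x, |w x| ≤ C) :
    MemLp (translateIntegral ψ w) ∞ (haar : Measure G) :=
  memLp_top_of_bound (continuous_translateIntegral hψ hw hC).aestronglyMeasurable _
    (ae_of_all _ fun g => abs_translateIntegral_le hψ hC g)

variable [SecondCountableTopology G] [T2Space G]

/-- The mean `m` is only finitely additive, so it cannot be moved inside the integral over `x`.
Instead, the left-hand side is a bounded functional of `ψ`, and it is left invariant because
translating `ψ` translates `translateIntegral ψ w`, which `m` does not see. Its use is that it
vanishes for `ψ` of integral zero. -/
theorem exists_mean_translateIntegral_eq {m : Lp ℝ ∞ (haar : Measure G) →ₗ[ℝ] ℝ}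
    (hpos : ∀ f, 0 ≤ f → 0 ≤ m f)
    (hone : m ((memLp_top_const (1 : ℝ)).toLp (fun _ : G => (1 : ℝ))) = 1)
    (hinv : ∀ (g : G) f, m (mk g • f) = m f) {w : G → ℝ} (hw : Continuous w) {C : ℝ}
    (hC : ∀ x, |w x| ≤ C) :
    ∃ c : ℝ, ∀ ψ : Lp ℝ 1 (haar : Measure G),
      m ((memLp_translateIntegral (L1.integrable_coeFn ψ) hw hC).toLp _) = c * ∫ x, ψ x ∂haar := by
  have hwi (ψ : Lp ℝ 1 (haar : Measure G)) (g : G) :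
      Integrable (fun x => ψ x * w (g⁻¹ * x)) haar :=
    (L1.integrable_coeFn ψ).mul_bdd
      (c := C) (by fun_prop : Continuous fun x => w (g⁻¹ * x)).aestronglyMeasurable
      (ae_of_all _ fun x => hC _)
  let J₀ : Lp ℝ 1 (haar : Measure G) →ₗ[ℝ] ℝ :=
    { toFun ψ := m ((memLp_translateIntegral (L1.integrable_coeFn ψ) hw hC).toLp _)
      map_add' ψ φ := by
        rw [← map_add, ← MemLp.toLp_add]
        congr 2
        ext g
        rw [Pi.add_apply, translateIntegral, translateIntegral, translateIntegral,
          ← integral_add (hwi ψ g) (hwi φ g)]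
        refine integral_congr_ae ?_
        filter_upwards [Lp.coeFn_add ψ φ] with x hx
        rw [hx, Pi.add_apply, add_mul]
      map_smul' c ψ := by
        rw [← map_smul, ← MemLp.toLp_const_smul]
        congr 2
        ext g
        rw [Pi.smul_apply, translateIntegral, translateIntegral, smul_eq_mul, RingHom.id_apply,
          ← integral_const_mul]
        refine integral_congr_ae ?_
        filter_upwards [Lp.coeFn_smul c ψ] with x hx
        rw [hx, Pi.smul_apply, smul_eq_mul, mul_assoc] }
  let J : Lp ℝ 1 (haar : Measure G) →L[ℝ] ℝ := J₀.mkContinuous C fun ψ => by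
    refine abs_mean_le hpos hone ?_
    filter_upwards [(memLp_translateIntegral (L1.integrable_coeFn ψ) hw hC).coeFn_toLp] with g hg
    rw [hg, L1.norm_eq_integral_norm]
    exact abs_translateIntegral_le (L1.integrable_coeFn ψ) hC g
  refine exists_eq_mul_integral_of_leftInvariant J fun h ψ => ?_
  refine Eq.trans ?_ (hinv h _)
  change m _ = m _
  rw [mk_smul_toLp]
  congr 2
  ext g
  have : (fun x => (mk h • ψ : Lp ℝ 1 (haar : Measure G)) x * w (g⁻¹ * x)) =ᵐ[haar]
      fun x => ψ (h * x) * w ((h * g)⁻¹ * (h * x)) := by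
    filter_upwards [smul_Lp_ae_eq (mk h) ψ] with x hx
    rw [hx]
    simp [mul_assoc]
  rw [translateIntegral, integral_congr_ae this, smul_eq_mul, translateIntegral]
  exact integral_mul_left_eq_self (fun x => ψ x * w ((h * g)⁻¹ * x)) h

end Reiter

/-! ### Averages of translates in `L¹(G)` -/

section Reiter

open Measure DomMulAct

variable {G : Type*} [Group G] [TopologicalSpace G] [IsTopologicalGroup G]
  [LocallyCompactSpace G] [SecondCountableTopology G]
  [MeasurableSpace G] [BorelSpace G]

/-- The vector `∫ ψ(x) φ(x ·) dx` of `L¹(G)`. -/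
noncomputable def averageTranslates (ψ : G → ℝ) (φ : Lp ℝ 1 (haar : Measure G)) :
    Lp ℝ 1 (haar : Measure G) :=
  ∫ x, ψ x • (mk x • φ) ∂haar

omit [SecondCountableTopology G] in
theorem isOrderedModule_L1 : IsOrderedModule ℝ (Lp ℝ 1 (haar : Measure G)) :=
  IsOrderedModule.of_smul_nonneg fun a ha b hb => by
    rw [← Lp.coeFn_nonneg] at hb ⊢
    filter_upwards [hb, Lp.coeFn_smul a b] with x hx hx'
    rw [hx']
    exact mul_nonneg ha hx

theorem continuous_mk_smul (φ : Lp ℝ 1 (haar : Measure G)) :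
    Continuous fun x : G => mk x • φ :=
  haveI : Fact ((1 : ℝ≥0∞) ≠ ∞) := ⟨ENNReal.one_ne_top⟩
  (continuous_id.smul continuous_const).comp (DomMulAct.mkHomeomorph (M := G)).continuous

theorem integrable_smul_mk_smul {ψ : G → ℝ} (hψ : Integrable ψ (haar : Measure G))
    (φ : Lp ℝ 1 (haar : Measure G)) : Integrable (fun x => ψ x • (mk x • φ)) haar := by
  refine (hψ.norm.mul_const ‖φ‖).mono'
    (hψ.1.smul (continuous_mk_smul φ).aestronglyMeasurable) (ae_of_all _ fun x => ?_)
  rw [norm_smul, norm_smul_Lp]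

theorem norm_averageTranslates_le {ψ : G → ℝ} (hψ : Integrable ψ (haar : Measure G))
    (φ : Lp ℝ 1 (haar : Measure G)) :
    ‖averageTranslates ψ φ‖ ≤ (∫ x, |ψ x| ∂haar) * ‖φ‖ := by
  rw [← integral_mul_const, averageTranslates]
  refine norm_integral_le_of_norm_le (hψ.abs.mul_const ‖φ‖) (ae_of_all _ fun x => ?_)
  rw [norm_smul, norm_smul_Lp, Real.norm_eq_abs]

theorem averageTranslates_sub_left {ψ χ : G → ℝ} (hψ : Integrable ψ (haar : Measure G))
    (hχ : Integrable χ (haar : Measure G)) (φ : Lp ℝ 1 (haar : Measure G)) :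
    averageTranslates (ψ - χ) φ = averageTranslates ψ φ - averageTranslates χ φ := by
  rw [averageTranslates, averageTranslates, averageTranslates,
    ← integral_sub (integrable_smul_mk_smul hψ φ) (integrable_smul_mk_smul hχ φ)]
  simp only [Pi.sub_apply, sub_smul]

/-- `φ ↦ ∫ ψ(x) φ(x ·) dx` as a linear map. -/
noncomputable def averageTranslatesₗ {ψ : G → ℝ} (hψ : Integrable ψ (haar : Measure G)) :
    Lp ℝ 1 (haar : Measure G) →ₗ[ℝ] Lp ℝ 1 (haar : Measure G) where
  toFun := averageTranslates ψ
  map_add' φ φ' := by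
    rw [averageTranslates, averageTranslates, averageTranslates,
      ← integral_add (integrable_smul_mk_smul hψ φ) (integrable_smul_mk_smul hψ φ')]
    simp only [smul_add]
  map_smul' c φ := by
    rw [averageTranslates, averageTranslates, RingHom.id_apply, ← integral_smul]
    refine integral_congr_ae (ae_of_all _ fun x => ?_)
    change ψ x • mk x • c • φ = c • ψ x • mk x • φ
    rw [smul_comm (mk x) c φ, smul_comm]

/-- The probability densities in `L¹(G)`. -/
def probabilityDensities (G : Type*) [Group G] [TopologicalSpace G] [IsTopologicalGroup G]
    [LocallyCompactSpace G] [MeasurableSpace G] [BorelSpace G] :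
    Set (Lp ℝ 1 (haar : Measure G)) :=
  {φ | 0 ≤ φ ∧ L1.integral φ = 1}

theorem mk_smul_mem_probabilityDensities {φ : Lp ℝ 1 (haar : Measure G)}
    (hφ : φ ∈ probabilityDensities G) (g : G) : mk g • φ ∈ probabilityDensities G := by
  have h := smul_Lp_ae_eq (mk g) φ
  refine ⟨?_, ?_⟩
  · rw [← Lp.coeFn_nonneg]
    have h1 := (measurePreserving_mul_left (haar : Measure G) g).quasiMeasurePreserving.ae
      ((Lp.coeFn_nonneg φ).2 hφ.1)
    filter_upwards [h, h1] with x hx hx'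
    rw [hx]
    exact hx'
  · rw [← hφ.2, L1.integral_eq_integral, L1.integral_eq_integral, integral_congr_ae h]
    exact integral_mul_left_eq_self (fun x => φ x) g

theorem averageTranslates_mem_probabilityDensities {ψ φ : Lp ℝ 1 (haar : Measure G)}
    (hψ : ψ ∈ probabilityDensities G) (hφ : φ ∈ probabilityDensities G) :
    averageTranslates ψ φ ∈ probabilityDensities G := by
  refine ⟨?_, ?_⟩
  · have := isOrderedModule_L1 (G := G)
    refine integral_nonneg_of_ae ?_
    filter_upwards [(Lp.coeFn_nonneg ψ).2 hψ.1] with x hx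
    exact smul_nonneg hx (mk_smul_mem_probabilityDensities hφ x).1
  · have h := (L1.integralCLM (α := G) (E := ℝ) (μ := haar)).integral_comp_comm
      (integrable_smul_mk_smul (L1.integrable_coeFn ψ) φ)
    have h2 (x : G) : L1.integralCLM (ψ x • (mk x • φ)) = ψ x := by
      rw [map_smul]
      rw [← L1.integral_eq, (mk_smul_mem_probabilityDensities hφ x).2, smul_eq_mul, mul_one]
    simp only [h2] at h
    rw [← hψ.2, L1.integral_eq_integral ψ, h, L1.integral_eq]
    rfl

theorem integral_comp_mul_right {E : Type*} [NormedAddCommGroup E] [NormedSpace ℝ E] (F : G → E)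
    (g : G) : ∫ x, F (x * g) ∂haar = modularCharacterFun g • ∫ x, F x ∂haar := by
  rw [← integral_smul_nnreal_measure, ← map_right_mul_eq_modularCharacterFun_smul]
  exact ((MeasurableEquiv.mulRight g).measurableEmbedding.integral_map F).symm

/-- The substitution `x ↦ x g⁻¹` moves the translation from `φ` to `ψ`; the modular factor in `χ` is
what keeps its integral equal to that of `ψ`. -/
theorem mk_smul_averageTranslates {ψ : G → ℝ} (hψ : Integrable ψ (haar : Measure G)) (g : G) :
    ∃ χ : G → ℝ, Integrable χ (haar : Measure G) ∧ ∫ x, χ x ∂haar = ∫ x, ψ x ∂haar ∧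
      ∀ φ, mk g • averageTranslates ψ φ = averageTranslates χ φ := by
  have hmap := map_right_mul_eq_modularCharacterFun_smul (haar : Measure G) g
  set c := modularCharacterFun g
  refine ⟨fun x => c * ψ (x * g⁻¹), ?_, ?_, fun φ => ?_⟩
  · refine Integrable.const_mul ?_ _
    have h1 : Integrable (fun x => ψ (x * g⁻¹)) (map (· * g) haar) := by
      refine ((MeasurableEquiv.mulRight g).measurableEmbedding.integrable_map_iff).2 ?_
      refine hψ.congr (ae_of_all _ fun x => ?_)
      simp
    rw [hmap] at h1
    exact (integrable_smul_measure (c := (c : ℝ≥0∞))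
      (by simpa using (modularCharacterFun_pos g).ne') ENNReal.coe_ne_top).1 h1
  · have := integral_comp_mul_right (fun x => ψ (x * g⁻¹)) g
    simp only [mul_inv_cancel_right] at this
    rw [this, integral_const_mul]; rfl
  · have h1 := integral_comp_mul_right (fun x => ψ (x * g⁻¹) • (mk x • φ)) g
    simp only [mul_inv_cancel_right] at h1
    rw [averageTranslates, averageTranslates]
    simp only [mul_smul (c : ℝ)]
    rw [integral_smul, ← NNReal.smul_def, ← h1]
    have h2 := (Lp.compMeasurePreservingₗᵢ ℝ (g • ·)
      (measurePreserving_smul g (haar : Measure G))).toContinuousLinearMap.integral_comp_comm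
      (integrable_smul_mk_smul hψ φ)
    refine h2.symm.trans (integral_congr_ae (ae_of_all _ fun x => ?_))
    change mk g • ψ x • mk x • φ = _
    rw [smul_comm, ← mul_smul, ← mk_mul]

omit [SecondCountableTopology G] in
theorem probabilityDensities_nonempty : (probabilityDensities G).Nonempty := by
  obtain ⟨K⟩ : Nonempty (TopologicalSpace.PositiveCompacts G) := inferInstance
  have hK0 : haar (closure (K : Set G)) ≠ 0 := fun h =>
    (measure_pos_of_nonempty_interior haar K.interior_nonempty).ne'
      (measure_mono_null subset_closure h)
  have hK1 : haar (closure (K : Set G)) ≠ ∞ := K.isCompact.closure.measure_lt_top.ne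
  have hpos : 0 < haar.real (closure (K : Set G)) := ENNReal.toReal_pos hK0 hK1
  refine ⟨indicatorConstLp 1 isClosed_closure.measurableSet hK1
    (haar.real (closure (K : Set G)))⁻¹, ?_, ?_⟩
  · rw [← Lp.coeFn_nonneg]
    filter_upwards [indicatorConstLp_coeFn (p := 1) (hs := isClosed_closure.measurableSet)
      (hμs := hK1) (c := (haar.real (closure (K : Set G)))⁻¹)] with x hx
    rw [hx]
    exact Set.indicator_nonneg (fun _ _ => inv_nonneg.2 hpos.le) x
  · rw [L1.integral_eq_integral, integral_indicatorConstLp, smul_eq_mul,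
      mul_inv_cancel₀ hpos.ne']

omit [SecondCountableTopology G] in
theorem convex_probabilityDensities : Convex ℝ (probabilityDensities G) := by
  have := isOrderedModule_L1 (G := G)
  rintro φ hφ ψ hψ a b ha hb hab
  refine ⟨add_nonneg (smul_nonneg ha hφ.1) (smul_nonneg hb hψ.1), ?_⟩
  rw [L1.integral_eq, map_add, map_smul, map_smul, ← L1.integral_eq, ← L1.integral_eq, hφ.2, hψ.2]
  simpa using hab

omit [SecondCountableTopology G] in
theorem lp_coeFn_sum {ι : Type*} {p : ℝ≥0∞} (s : Finset ι) (f : ι → Lp ℝ p (haar : Measure G)) :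
    ⇑(∑ i ∈ s, f i) =ᵐ[haar] fun x => ∑ i ∈ s, f i x := by
  classical
  induction s using Finset.induction_on with
  | empty =>
    filter_upwards [Lp.coeFn_zero ℝ p (haar : Measure G)] with x
    simp
  | insert i s hi ih =>
    rw [Finset.sum_insert hi]
    filter_upwards [ih, Lp.coeFn_add (f i) (∑ i ∈ s, f i)] with x h1 h2
    rw [h2, Pi.add_apply, h1, Finset.sum_insert hi]

variable [T2Space G]

/-- Otherwise Hahn–Banach separates `0` from the convex set of tuples of averages. Evaluating the
separating functional along the translates of one density gives a function on `G` that is at least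
some `u > 0`, yet has mean `0`. -/
theorem exists_norm_averageTranslates_lt (hG : IsAmenableGroup G) {N : ℕ}
    (ψ : Fin N → Lp ℝ 1 (haar : Measure G)) (hψ : ∀ k, ∫ x, ψ k x ∂haar = 0) {ε : ℝ}
    (hε : 0 < ε) : ∃ φ ∈ probabilityDensities G, ∀ k, ‖averageTranslates (ψ k) φ‖ < ε := by
  obtain ⟨m, hpos, hone, hinv⟩ := hG
  by_contra! hcon
  let A : Lp ℝ 1 (haar : Measure G) →ₗ[ℝ] (Fin N → Lp ℝ 1 (haar : Measure G)) :=
    LinearMap.pi fun k => averageTranslatesₗ (L1.integrable_coeFn (ψ k))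
  have hA (φ k) : A φ k = averageTranslates (ψ k) φ := rfl
  have h0 : (0 : Fin N → Lp ℝ 1 (haar : Measure G)) ∉ closure (A '' probabilityDensities G) := by
    intro h
    obtain ⟨_, ⟨φ, hφ, rfl⟩, hd⟩ := Metric.mem_closure_iff.1 h ε hε
    obtain ⟨k, hk⟩ := hcon φ hφ
    rw [dist_zero_left] at hd
    exact absurd (((norm_le_pi_norm (A φ) k).trans_lt hd)) (not_lt.2 (by rwa [hA]))
  obtain ⟨f, u, hu0, hu⟩ := geometric_hahn_banach_point_closed
    (convex_probabilityDensities.linear_image A).closure isClosed_closure h0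
  rw [map_zero] at hu0
  obtain ⟨v, hv⟩ := probabilityDensities_nonempty (G := G)
  let f' (k : Fin N) : Lp ℝ 1 (haar : Measure G) →L[ℝ] ℝ :=
    f.comp (ContinuousLinearMap.single ℝ (fun _ => Lp ℝ 1 (haar : Measure G)) k)
  -- With this weight, the separating functional at the translate of `v` by `g⁻¹` is a sum of
  -- functions `translateIntegral (ψ k) (w k)` of `g`, to which the mean applies.
  let w (k : Fin N) (x : G) : ℝ := f' k (mk x • v)
  have hw (k) : Continuous (w k) := (f' k).continuous.comp (continuous_mk_smul v)
  have hC (k) (x) : |w k x| ≤ ‖f' k‖ * ‖v‖ := by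
    simpa using (f' k).le_opNorm (mk x • v)
  have hint (k) := L1.integrable_coeFn (ψ k)
  have hval (g : G) : f (A (mk g⁻¹ • v)) = ∑ k, translateIntegral (ψ k) (w k) g := by
    have h1 : A (mk g⁻¹ • v) = ∑ k, Pi.single k (A (mk g⁻¹ • v) k) :=
      (Finset.univ_sum_single _).symm
    rw [h1, _root_.map_sum]
    refine Finset.sum_congr rfl fun k _ => ?_
    change f' k _ = _
    rw [hA, averageTranslates, ← (f' k).integral_comp_comm (integrable_smul_mk_smul (hint k) _)]
    refine integral_congr_ae (ae_of_all _ fun x => ?_)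
    simp only [map_smul, smul_eq_mul, w]
    rw [← mul_smul, ← mk_mul]
  let F : Lp ℝ ∞ (haar : Measure G) :=
    ∑ k, (memLp_translateIntegral (hint k) (hw k) (hC k)).toLp _
  have hF0 : m F = 0 := by
    rw [_root_.map_sum]
    refine Finset.sum_eq_zero fun k _ => ?_
    obtain ⟨c, hc⟩ := exists_mean_translateIntegral_eq hpos hone hinv (hw k) (hC k)
    rw [hc, hψ, mul_zero]
  have hFu : u ≤ m F := by
    refine le_mean_of_ae_le hpos hone ?_
    have hcoe : ∀ᵐ g ∂haar, ∀ k, (memLp_translateIntegral (hint k) (hw k) (hC k)).toLp _ g =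
        translateIntegral (ψ k) (w k) g :=
      ae_all_iff.2 fun k => (memLp_translateIntegral (hint k) (hw k) (hC k)).coeFn_toLp
    filter_upwards [hcoe, lp_coeFn_sum Finset.univ
      fun k => (memLp_translateIntegral (hint k) (hw k) (hC k)).toLp _] with g hg hsum
    rw [hsum, Finset.sum_congr rfl fun k _ => hg k, ← hval]
    exact (hu _ (subset_closure ⟨_, mk_smul_mem_probabilityDensities hv _, rfl⟩)).le
  linarith

end Reiter

/-! ### Reiter's condition and almost invariant vectors in `L²(G)` -/

section Reiter

open Measure DomMulAct

theorem norm_sq_eq_integral_sq {α : Type*} [MeasurableSpace α] {μ : Measure α}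
    (f : Lp ℝ 2 μ) : ‖f‖ ^ 2 = ∫ x, f x ^ 2 ∂μ := by
  rw [← real_inner_self_eq_norm_sq, L2.inner_def]
  refine integral_congr_ae (ae_of_all _ fun x => ?_)
  simp [pow_two]

variable {G : Type*} [Group G] [TopologicalSpace G] [IsTopologicalGroup G]
  [LocallyCompactSpace G] [SecondCountableTopology G] [T2Space G]
  [MeasurableSpace G] [BorelSpace G]

theorem norm_eq_one_of_mem_probabilityDensities {G : Type*} [Group G] [TopologicalSpace G]
    [IsTopologicalGroup G] [LocallyCompactSpace G] [MeasurableSpace G] [BorelSpace G]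
    {φ : Lp ℝ 1 (haar : Measure G)} (hφ : φ ∈ probabilityDensities G) : ‖φ‖ = 1 := by
  rw [L1.norm_eq_integral_norm, ← hφ.2, L1.integral_eq_integral]
  refine integral_congr_ae ?_
  filter_upwards [(Lp.coeFn_nonneg φ).2 hφ.1] with x hx
  exact Real.norm_of_nonneg hx

/-- Separability of the mean-zero subspace of `L¹` allows one sequence to serve all `ψ`: the `n`-th
density handles the first `n + 1` members of a dense sequence with error `1 / (n + 1)`. The bound
`‖averageTranslates ψ φ‖ ≤ ‖ψ‖₁` for densities `φ` passes from the dense sequence to every `ψ`. -/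
theorem exists_seq_averageTranslates_tendsto (hG : IsAmenableGroup G) :
    ∃ φ : ℕ → Lp ℝ 1 (haar : Measure G), (∀ n, φ n ∈ probabilityDensities G) ∧
      ∀ ψ : G → ℝ, Integrable ψ haar → ∫ x, ψ x ∂haar = 0 →
        Tendsto (fun n => averageTranslates ψ (φ n)) atTop (𝓝 0) := by
  let Z : Submodule ℝ (Lp ℝ 1 (haar : Measure G)) :=
    (L1.integralCLM (α := G) (E := ℝ) (μ := haar)).ker
  have : Fact ((1 : ℝ≥0∞) ≠ ∞) := ⟨ENNReal.one_ne_top⟩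
  obtain ⟨d, hd⟩ := TopologicalSpace.exists_dense_seq Z
  have hZ (z : Z) : ∫ x, (z : Lp ℝ 1 (haar : Measure G)) x ∂haar = 0 := by
    rw [← L1.integral_eq_integral, L1.integral_eq]
    exact z.2
  choose φ hφ hφd using fun n : ℕ => exists_norm_averageTranslates_lt hG
    (fun k : Fin (n + 1) => (d k : Lp ℝ 1 (haar : Measure G))) (fun k => hZ _)
    (Nat.one_div_pos_of_nat (α := ℝ) (n := n))
  refine ⟨φ, hφ, fun ψ hψ hψ0 => ?_⟩
  rw [Metric.tendsto_atTop]
  intro ε hε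
  have hψZ : hψ.toL1 ψ ∈ Z := by
    change L1.integralCLM _ = 0
    rw [← L1.integral_eq, L1.integral_eq_integral, integral_congr_ae hψ.coeFn_toL1, hψ0]
  obtain ⟨_, ⟨k, rfl⟩, hk⟩ := Metric.mem_closure_iff.1 (hd ⟨_, hψZ⟩) (ε / 2) (half_pos hε)
  obtain ⟨N, hN⟩ := exists_nat_one_div_lt (half_pos hε)
  refine ⟨max N k, fun n hn => ?_⟩
  have hkn : k < n + 1 := Nat.lt_succ_of_le ((le_max_right _ _).trans hn)
  have h1 := hφd n ⟨k, hkn⟩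
  have h2 : (1 : ℝ) / (n + 1) ≤ 1 / (N + 1) :=
    Nat.one_div_le_one_div ((le_max_left _ _).trans hn)
  have hdk := L1.integrable_coeFn (d k : Lp ℝ 1 (haar : Measure G))
  have h3 := averageTranslates_sub_left hψ hdk (φ n)
  have h4 := norm_averageTranslates_le (hψ.sub hdk) (φ n)
  have h5 : ∫ x, |(ψ - ((d k : Lp ℝ 1 (haar : Measure G)) : G → ℝ)) x| ∂haar
      = ‖hψ.toL1 ψ - d k‖ := by
    rw [L1.norm_eq_integral_norm]
    refine integral_congr_ae ?_
    filter_upwards [hψ.coeFn_toL1, Lp.coeFn_sub (hψ.toL1 ψ) (d k : Lp ℝ 1 (haar : Measure G))]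
      with x hx hx'
    rw [hx', Pi.sub_apply, Pi.sub_apply, hx, Real.norm_eq_abs]
  rw [h5, norm_eq_one_of_mem_probabilityDensities (hφ n), mul_one, h3] at h4
  have h6 : ‖hψ.toL1 ψ - d k‖ < ε / 2 := by
    rw [← dist_eq_norm]; exact hk
  rw [dist_zero_right]
  have h7 := norm_le_norm_sub_add (averageTranslates ψ (φ n))
    (averageTranslates (d k : Lp ℝ 1 (haar : Measure G)) (φ n))
  simp only at h1
  linarith

theorem exists_almostInvariant_probabilityDensities (hG : IsAmenableGroup G) :
    ∃ φ : ℕ → Lp ℝ 1 (haar : Measure G), (∀ n, φ n ∈ probabilityDensities G) ∧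
      ∀ g : G, Tendsto (fun n => ‖mk g • φ n - φ n‖) atTop (𝓝 0) := by
  obtain ⟨φ, hφ, h⟩ := exists_seq_averageTranslates_tendsto hG
  obtain ⟨χ, hχ⟩ := probabilityDensities_nonempty (G := G)
  -- Smoothing by a fixed density `χ` turns a translation into a change of `χ`: the difference to be
  -- estimated is the average with weight `χ' - χ`, which has integral zero.
  refine ⟨fun n => averageTranslates χ (φ n),
    fun n => averageTranslates_mem_probabilityDensities hχ (hφ n), fun g => ?_⟩
  have hi := L1.integrable_coeFn χ
  obtain ⟨χ', hχ', hint, heq⟩ := mk_smul_averageTranslates hi g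
  simp only [heq, ← averageTranslates_sub_left hχ' hi]
  rw [← norm_zero (E := Lp ℝ 1 (haar : Measure G))]
  refine (h _ (hχ'.sub hi) ?_).norm
  simp only [Pi.sub_apply]
  rw [integral_sub hχ' hi, hint, sub_self]

/-- An amenable group has almost invariant unit vectors in `L²(G)`. -/
theorem exists_almostInvariant_L2 (hG : IsAmenableGroup G) :
    ∃ f : ℕ → Lp ℝ 2 (haar : Measure G), (∀ n, ‖f n‖ = 1) ∧
      ∀ g : G, Tendsto (fun n => ‖mk g • f n - f n‖) atTop (𝓝 0) := by
  obtain ⟨φ, hφ, h⟩ := exists_almostInvariant_probabilityDensities hG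
  have hnn (n) : ∀ᵐ x ∂haar, 0 ≤ φ n x := (Lp.coeFn_nonneg (φ n)).2 (hφ n).1
  have hmem (n) : MemLp (fun x => √(φ n x)) 2 (haar : Measure G) := by
    rw [memLp_two_iff_integrable_sq (Real.continuous_sqrt.comp_aestronglyMeasurable
      (Lp.aestronglyMeasurable _))]
    refine (L1.integrable_coeFn (φ n)).congr ?_
    filter_upwards [hnn n] with x hx
    exact (Real.sq_sqrt hx).symm
  refine ⟨fun n => (hmem n).toLp _, fun n => ?_, fun g => ?_⟩
  · rw [← sq_eq_sq₀ (norm_nonneg _) zero_le_one, norm_sq_eq_integral_sq, one_pow, ← (hφ n).2,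
      L1.integral_eq_integral]
    refine integral_congr_ae ?_
    filter_upwards [hnn n, (hmem n).coeFn_toLp] with x hx hx'
    rw [hx', Real.sq_sqrt hx]
  -- Square roots turn `L¹` estimates into `L²` ones by `(√a - √b)² ≤ |a - b|`.
  · have key (n) : ‖mk g • (hmem n).toLp _ - (hmem n).toLp _‖ ≤ √‖mk g • φ n - φ n‖ := by
      refine Real.le_sqrt_of_sq_le ?_
      rw [norm_sq_eq_integral_sq, L1.norm_eq_integral_norm]
      refine integral_mono_ae ?_ (L1.integrable_coeFn _).norm ?_
      · exact (Lp.memLp _).integrable_sq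
      · have hq := (measurePreserving_mul_left (haar : Measure G) g).quasiMeasurePreserving
        filter_upwards [hnn n, hq.ae (hnn n), (hmem n).coeFn_toLp, hq.ae (hmem n).coeFn_toLp,
          smul_Lp_ae_eq (mk g) (φ n), smul_Lp_ae_eq (mk g) ((hmem n).toLp _),
          Lp.coeFn_sub (mk g • φ n) (φ n),
          Lp.coeFn_sub (mk g • (hmem n).toLp _) ((hmem n).toLp _)] with x h1 h2 h3 h4 h5 h6 h7 h8
        rw [h7, h8, Pi.sub_apply, Pi.sub_apply, h5, h6, h3]
        simp only [Equiv.symm_apply_apply, smul_eq_mul]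
        rw [h4]
        set a := φ n (g * x)
        set b := φ n x
        have ha := Real.sq_sqrt h2
        have hb := Real.sq_sqrt h1
        have ha' := Real.sqrt_nonneg a
        have hb' := Real.sqrt_nonneg b
        have hab : a - b = (√a - √b) * (√a + √b) := by linarith [ha, hb]
        rw [Real.norm_eq_abs, hab, abs_mul, ← sq_abs, pow_two]
        refine mul_le_mul_of_nonneg_left ?_ (abs_nonneg _)
        rw [abs_of_nonneg (add_nonneg ha' hb')]
        exact abs_le.2 ⟨by linarith, by linarith⟩
    refine squeeze_zero (fun n => norm_nonneg _) key ?_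
    have := (Real.continuous_sqrt.tendsto 0).comp (h g)
    rwa [Real.sqrt_zero] at this

end Reiter

/-! ### Positive semidefinite kernels -/

section PositiveSemidefiniteKernels

/-- Positive semidefinite real kernels. -/
def IsPSDKernel {S : Type*} (K : S → S → ℝ) : Prop :=
  ∀ (s : Finset S) (a : S → ℝ), 0 ≤ ∑ U ∈ s, ∑ V ∈ s, a U * a V * K U V

/-- The bilinear form on finitely supported functions defined by a kernel. -/
noncomputable def kernelForm {S : Type*} (K : S → S → ℝ) : LinearMap.BilinForm ℝ (S →₀ ℝ) :=
  Finsupp.linearCombination ℝ fun U => Finsupp.linearCombination ℝ (K U)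

variable {S : Type*}

theorem kernelForm_apply (K : S → S → ℝ) (c d : S →₀ ℝ) :
    kernelForm K c d = c.sum fun U a => d.sum fun V b => a * (b * K U V) := by
  simp [kernelForm, Finsupp.linearCombination_apply, Finsupp.sum, LinearMap.sum_apply,
    Finset.mul_sum]

theorem kernelForm_self (K : S → S → ℝ) (c : S →₀ ℝ) :
    kernelForm K c c = ∑ U ∈ c.support, ∑ V ∈ c.support, c U * c V * K U V := by
  simp only [kernelForm_apply, Finsupp.sum, mul_assoc]

theorem kernelForm_add (K L : S → S → ℝ) (c d : S →₀ ℝ) :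
    kernelForm (fun U V => K U V + L U V) c d = kernelForm K c d + kernelForm L c d := by
  simp only [kernelForm_apply, Finsupp.sum, mul_add, Finset.sum_add_distrib]

theorem kernelForm_smul (r : ℝ) (K : S → S → ℝ) (c d : S →₀ ℝ) :
    kernelForm (fun U V => r * K U V) c d = r * kernelForm K c d := by
  simp only [kernelForm_apply, Finsupp.sum, Finset.mul_sum, mul_left_comm r]

theorem kernelForm_mapDomain (K : S → S → ℝ) (τ : S → S) (c d : S →₀ ℝ) :
    kernelForm K (c.mapDomain τ) (d.mapDomain τ) = kernelForm (fun U V => K (τ U) (τ V)) c d := by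
  rw [kernelForm_apply, kernelForm_apply, Finsupp.sum_mapDomain_index (by simp)
    (fun U a b => by simp only [add_mul, Finsupp.sum_add])]
  refine Finsupp.sum_congr fun U _ => ?_
  rw [Finsupp.sum_mapDomain_index (by simp) (fun V a b => by ring)]

theorem kernelForm_inner {E : Type*} [NormedAddCommGroup E] [InnerProductSpace ℝ E] (ξ : S → E)
    (c d : S →₀ ℝ) :
    kernelForm (fun U V => inner ℝ (ξ U) (ξ V)) c d =
      inner ℝ (Finsupp.linearCombination ℝ ξ c) (Finsupp.linearCombination ℝ ξ d) := by
  simp only [kernelForm_apply, Finsupp.linearCombination_apply, Finsupp.sum, sum_inner, inner_sum,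
    inner_smul_left, inner_smul_right, RCLike.conj_to_real, Finset.mul_sum]
  rw [Finset.sum_comm]
  exact Finset.sum_congr rfl fun _ _ => Finset.sum_congr rfl fun _ _ => by ring

theorem kernelForm_comm {K : S → S → ℝ} (hK : ∀ U V, K U V = K V U) (c d : S →₀ ℝ) :
    kernelForm K c d = kernelForm K d c := by
  rw [kernelForm_apply, kernelForm_apply, Finsupp.sum, Finsupp.sum]
  simp only [Finsupp.sum]
  rw [Finset.sum_comm]
  exact Finset.sum_congr rfl fun U _ => Finset.sum_congr rfl fun V _ => by rw [hK V U]; ring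

theorem IsPSDKernel.kernelForm_nonneg {K : S → S → ℝ} (hK : IsPSDKernel K) (c : S →₀ ℝ) :
    0 ≤ kernelForm K c c := by
  rw [kernelForm_self]
  exact hK _ _

/-- The Cauchy–Schwarz inequality for a positive semidefinite kernel. -/
theorem IsPSDKernel.sq_kernelForm_le {K : S → S → ℝ} (hK : IsPSDKernel K)
    (hsymm : ∀ U V, K U V = K V U) (c d : S →₀ ℝ) :
    kernelForm K c d ^ 2 ≤ kernelForm K c c * kernelForm K d d := by
  -- The form on `c + x d` is a nonnegative quadratic polynomial in `x`, so its discriminant is at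
  -- most zero.
  have h (x : ℝ) : 0 ≤ kernelForm K d d * (x * x) + 2 * kernelForm K c d * x
      + kernelForm K c c := by
    have := hK.kernelForm_nonneg (c + x • d)
    simp only [map_add, map_smul, LinearMap.add_apply, LinearMap.smul_apply, smul_eq_mul,
      kernelForm_comm hsymm d c] at this
    linarith
  have := discrim_le_zero h
  rw [discrim] at this
  linarith

theorem isPSDKernel_one : IsPSDKernel fun _ _ : S => (1 : ℝ) := fun s a => by
  simp only [mul_one, ← Finset.sum_mul_sum]
  exact mul_self_nonneg _

theorem IsPSDKernel.const_mul {K : S → S → ℝ} (hK : IsPSDKernel K) {r : ℝ} (hr : 0 ≤ r) :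
    IsPSDKernel fun U V => r * K U V := fun s a => by
  simp only [mul_left_comm _ r, ← Finset.mul_sum]
  exact mul_nonneg hr (hK s a)

theorem IsPSDKernel.hasSum {K : ℕ → S → S → ℝ} (hK : ∀ n, IsPSDKernel (K n)) {L : S → S → ℝ}
    (hL : ∀ U V, HasSum (fun n => K n U V) (L U V)) : IsPSDKernel L := fun s a =>
  (hasSum_sum fun U _ => hasSum_sum fun V _ => (hL U V).mul_left (a U * a V)).nonneg
    fun n => hK n s a

/-- For fixed `x` the indicator of `A U ∩ A V` is a product, so it can be absorbed into the
coefficients `a U` and `a V`; then integrate over `x` against `F ≥ 0`. With `F = 1` this gives the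
powers of `μ(A U ∩ A V)` by induction. -/
theorem IsPSDKernel.mul_setIntegral {α : Type*} [MeasurableSpace α] {μ : Measure α}
    {A : S → Set α} (hA : ∀ U, MeasurableSet (A U)) {K : S → S → ℝ} (hK : IsPSDKernel K)
    {F : α → ℝ} (hF : 0 ≤ᵐ[μ] F) (hint : ∀ U, IntegrableOn F (A U) μ) :
    IsPSDKernel fun U V => K U V * ∫ x in A U ∩ A V, F x ∂μ := fun s a => by
  have h1 (U V : S) : ∫ x in A U ∩ A V, F x ∂μ =
      ∫ x, (A U ∩ A V).indicator F x ∂μ := (integral_indicator ((hA U).inter (hA V))).symm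
  have h2 (U V : S) : Integrable ((A U ∩ A V).indicator F) μ :=
    ((hint U).mono_set Set.inter_subset_left).integrable_indicator ((hA U).inter (hA V))
  simp only [h1, ← mul_assoc, ← integral_const_mul]
  rw [← Finset.sum_congr rfl fun U _ => integral_finsetSum s fun V _ => (h2 U V).const_mul _,
    ← integral_finsetSum s fun U _ => integrable_finsetSum s fun V _ => (h2 U V).const_mul _]
  refine integral_nonneg_of_ae ?_
  filter_upwards [hF] with x hx
  have h3 : ∑ U ∈ s, ∑ V ∈ s, a U * a V * K U V * (A U ∩ A V).indicator F x =
      F x * ∑ U ∈ s, ∑ V ∈ s,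
        (a U * (A U).indicator 1 x) * (a V * (A V).indicator 1 x) * K U V := by
    simp only [Finset.mul_sum]
    refine Finset.sum_congr rfl fun U _ => Finset.sum_congr rfl fun V _ => ?_
    by_cases hU : x ∈ A U <;> by_cases hV : x ∈ A V <;> simp [hU, hV, mul_comm]
  rw [h3]
  exact mul_nonneg hx (hK s fun U => a U * (A U).indicator 1 x)

theorem isPSDKernel_measure_inter_pow {α : Type*} [MeasurableSpace α] {μ : Measure α}
    {A : S → Set α} (hA : ∀ U, MeasurableSet (A U)) (hfin : ∀ U, μ (A U) ≠ ∞) (n : ℕ) :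
    IsPSDKernel fun U V => μ.real (A U ∩ A V) ^ n := by
  induction n with
  | zero => simpa using isPSDKernel_one
  | succ n ih =>
    have := ih.mul_setIntegral (μ := μ) hA (F := fun _ => (1 : ℝ))
      (ae_of_all _ fun _ => zero_le_one)
      fun U => integrableOn_const (hfin U)
    simpa [pow_succ] using this

/-- The entire function `(exp z - 1) / z`. -/
noncomputable def expSubOneDiv (z : ℝ) : ℝ := ∑' n : ℕ, z ^ n / (n + 1).factorial

theorem hasSum_expSubOneDiv (z : ℝ) :
    HasSum (fun n : ℕ => z ^ n / (n + 1).factorial) (expSubOneDiv z) := by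
  refine Summable.hasSum (Summable.of_norm_bounded (Real.summable_pow_div_factorial |z|)
    fun n => ?_)
  rw [norm_div, norm_pow, Real.norm_eq_abs, Real.norm_natCast]
  gcongr
  exact Nat.le_succ n

theorem mul_expSubOneDiv (z : ℝ) : z * expSubOneDiv z = Real.exp z - 1 := by
  have h1 : HasSum (fun n : ℕ => z ^ n / n.factorial) (Real.exp z) := by
    rw [Real.exp_eq_exp_ℝ]
    exact NormedSpace.expSeries_div_hasSum_exp z
  have h2 := (hasSum_nat_add_iff' 1).2 h1
  have h3 := (hasSum_expSubOneDiv z).mul_left z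
  simp only [Finset.range_one, Finset.sum_singleton, pow_zero, Nat.factorial_zero, Nat.cast_one,
    div_one] at h2
  refine h3.unique (h2.congr_fun ?_)
  intro n
  ring

theorem isPSDKernel_expSubOneDiv {α : Type*} [MeasurableSpace α] {μ : Measure α}
    {A : S → Set α} (hA : ∀ U, MeasurableSet (A U)) (hfin : ∀ U, μ (A U) ≠ ∞) {t : ℝ}
    (ht : 0 ≤ t) : IsPSDKernel fun U V => expSubOneDiv (t * μ.real (A U ∩ A V)) := by
  refine IsPSDKernel.hasSum (fun n => ((isPSDKernel_measure_inter_pow hA hfin n).const_mul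
    (r := t ^ n / (n + 1).factorial) (by positivity))) fun U V => ?_
  refine (hasSum_expSubOneDiv _).congr_fun ?_
  intro n
  ring

end PositiveSemidefiniteKernels

/-! ### Void processes and their exponential vectors -/

section VoidProcess

open Measure DomMulAct

/-- The Borel sets of finite Haar measure. -/
abbrev FiniteHaarSet (G : Type*) [Group G] [TopologicalSpace G] [IsTopologicalGroup G]
    [LocallyCompactSpace G] [MeasurableSpace G] [BorelSpace G] : Type _ :=
  {U : Set G // MeasurableSet U ∧ (haar : Measure G) U ≠ ∞}

variable {G : Type*} [Group G] [TopologicalSpace G] [IsTopologicalGroup G]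
  [LocallyCompactSpace G] [MeasurableSpace G] [BorelSpace G]

namespace FiniteHaarSet

instance : EmptyCollection (FiniteHaarSet G) := ⟨⟨∅, .empty, by simp⟩⟩

theorem coe_empty : (∅ : FiniteHaarSet G).1 = ∅ := rfl

/-- The translate `gU`. -/
def translate (g : G) (U : FiniteHaarSet G) : FiniteHaarSet G :=
  ⟨g • U.1, U.2.1.const_smul g, by rw [measure_smul]; exact U.2.2⟩

end FiniteHaarSet

/-- A probability preserving action together with an equivariant random subset `pts` of `G` whose
void probabilities are those of a Poisson process, and whose void events generate the
σ-algebra. -/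
structure IsVoidProcess {X : Type*} [MeasurableSpace X] [MulAction G X] (t : ℝ) (pts : X → Set G)
    (μ : Measure X) : Prop where
  isProbabilityMeasure : IsProbabilityMeasure μ
  pos : 0 < t
  pts_smul : ∀ (g : G) x, pts (g • x) = g • pts x
  generate : ‹MeasurableSpace X› =
    .generateFrom (Set.range fun U : FiniteHaarSet G => {x | Disjoint (pts x) U.1})
  measure_void : ∀ U : FiniteHaarSet G, μ.real {x | Disjoint (pts x) U.1} =
    Real.exp (-(t * (haar : Measure G).real U.1))

namespace IsVoidProcess

variable {X : Type*} [MeasurableSpace X] [MulAction G X] {t : ℝ} {pts : X → Set G}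
    {μ : Measure X}

omit [MeasurableSpace X] [MulAction G X] in
theorem void_inter (U V : FiniteHaarSet G) :
    {x | Disjoint (pts x) U.1} ∩ {x | Disjoint (pts x) V.1} =
      {x | Disjoint (pts x) (U.1 ∪ V.1)} := by
  ext x
  simp [Set.disjoint_union_right]

omit [MeasurableSpace X] [MulAction G X] in
theorem isPiSystem : IsPiSystem
    (Set.range fun U : FiniteHaarSet G => {x | Disjoint (pts x) U.1}) := by
  rintro _ ⟨U, rfl⟩ _ ⟨V, rfl⟩ _
  exact ⟨⟨U.1 ∪ V.1, U.2.1.union V.2.1, measure_union_ne_top U.2.2 V.2.2⟩, (void_inter U V).symm⟩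

variable (h : IsVoidProcess t pts μ)
include h

theorem measurableSet_void (U : FiniteHaarSet G) : MeasurableSet {x | Disjoint (pts x) U.1} := by
  rw [h.generate]
  exact .basic _ ⟨U, rfl⟩

theorem preimage_smul_void (g : G) (U : FiniteHaarSet G) :
    (g⁻¹ • ·) ⁻¹' {x | Disjoint (pts x) U.1} = {x | Disjoint (pts x) (U.translate g).1} := by
  ext x
  simp only [Set.mem_preimage, Set.mem_ofPred_eq, h.pts_smul]
  rw [FiniteHaarSet.translate, ← Set.disjoint_smul_set (a := g), smul_inv_smul]

theorem measurableConstSMul : MeasurableConstSMul G X := by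
  refine ⟨fun g => ?_⟩
  have h1 : @Measurable X X ‹_› (.generateFrom (Set.range fun U : FiniteHaarSet G =>
      {x | Disjoint (pts x) U.1})) (g • ·) := by
    refine measurable_generateFrom ?_
    rintro _ ⟨U, rfl⟩
    have := h.preimage_smul_void g⁻¹ U
    rw [inv_inv] at this
    rw [this]
    exact h.measurableSet_void _
  rwa [← h.generate] at h1

/-- Void events form a generating π-system and their probabilities depend only on Haar measure,
which is left invariant. -/
theorem smulInvariantMeasure : SMulInvariantMeasure G X μ := by
  have := h.isProbabilityMeasure
  have := h.measurableConstSMul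
  refine ⟨fun g s hs => ?_⟩
  rw [← map_apply (measurable_const_smul g) hs]
  have : IsProbabilityMeasure (map (g • ·) μ) :=
    isProbabilityMeasure_map (measurable_const_smul g).aemeasurable
  congr 1
  refine ext_of_generate_finite _ h.generate isPiSystem ?_ (by simp)
  rintro _ ⟨U, rfl⟩
  have h1 := h.preimage_smul_void g⁻¹ U
  rw [inv_inv] at h1
  rw [map_apply (measurable_const_smul g) (h.measurableSet_void U), h1,
    ← measureReal_eq_measureReal_iff, h.measure_void, h.measure_void]
  simp [FiniteHaarSet.translate, measureReal_def, measure_smul]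

end IsVoidProcess

end VoidProcess

section VoidProcess

open Measure DomMulAct

variable {G : Type*} [Group G] [TopologicalSpace G] [IsTopologicalGroup G]
  [LocallyCompactSpace G] [MeasurableSpace G] [BorelSpace G]

theorem linearCombination_mapDomain_translate {X : Type*} [MeasurableSpace X] [MulAction G X]
    {μ : Measure X} [MeasurableConstSMul G X] [SMulInvariantMeasure G X μ]
    {ξ : FiniteHaarSet G → Lp ℝ 2 μ}
    (hξ : ∀ (g : G) (U : FiniteHaarSet G), ξ (U.translate g) = mk g⁻¹ • ξ U)
    (g : G) (c : FiniteHaarSet G →₀ ℝ) :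
    Finsupp.linearCombination ℝ ξ (c.mapDomain (FiniteHaarSet.translate g)) =
      mk g⁻¹ • Finsupp.linearCombination ℝ ξ c := by
  rw [Finsupp.linearCombination_mapDomain, Finsupp.linearCombination_apply,
    Finsupp.linearCombination_apply, Finsupp.sum, Finsupp.sum, Finset.smul_sum]
  refine Finset.sum_congr rfl fun U _ => ?_
  rw [Function.comp_apply, hξ, smul_comm]

namespace IsVoidProcess

variable {X : Type*} [MeasurableSpace X] [MulAction G X] {t : ℝ} {pts : X → Set G}
    {μ : Measure X} [IsProbabilityMeasure μ]

/-- The indicator function of a void event in `L²`. -/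
noncomputable def voidVector (h : IsVoidProcess t pts μ) (U : FiniteHaarSet G) : Lp ℝ 2 μ :=
  indicatorConstLp 2 (h.measurableSet_void U) (measure_ne_top μ _) 1

/-- The normalised and centered indicator function of a void event in `L²`. -/
noncomputable def expVector (h : IsVoidProcess t pts μ) (U : FiniteHaarSet G) : Lp ℝ 2 μ :=
  Real.exp (t * (haar : Measure G).real U.1) • h.voidVector U - h.voidVector ∅

variable (h : IsVoidProcess t pts μ)
include h

theorem inner_voidVector (U V : FiniteHaarSet G) :
    inner ℝ (h.voidVector U) (h.voidVector V) =
      Real.exp (-(t * (haar : Measure G).real (U.1 ∪ V.1))) := by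
  rw [voidVector, voidVector, L2.real_inner_indicatorConstLp_one_indicatorConstLp_one,
    void_inter U V]
  exact h.measure_void ⟨U.1 ∪ V.1, U.2.1.union V.2.1, measure_union_ne_top U.2.2 V.2.2⟩

theorem inner_voidVector_empty (U : FiniteHaarSet G) :
    inner ℝ (h.voidVector ∅) (h.voidVector U) = Real.exp (-(t * (haar : Measure G).real U.1)) := by
  rw [inner_voidVector, FiniteHaarSet.coe_empty, Set.empty_union]

theorem inner_voidVector_empty_left (f : Lp ℝ 2 μ) :
    inner ℝ (h.voidVector ∅) f = ∫ x, f x ∂μ := by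
  rw [voidVector, L2.inner_indicatorConstLp_one]
  simp [FiniteHaarSet.coe_empty]

/-- The identity `λ(U) + λ(V) - λ(U ∪ V) = λ(U ∩ V)` turns the void probability of `U ∪ V` into a
function of the intersection, and subtracting the constant `1` removes the zeroth term of the
exponential series. -/
theorem inner_expVector (U V : FiniteHaarSet G) :
    inner ℝ (h.expVector U) (h.expVector V) =
      Real.exp (t * (haar : Measure G).real (U.1 ∩ V.1)) - 1 := by
  have h1 : inner ℝ (h.voidVector U) (h.voidVector ∅) =
      Real.exp (-(t * (haar : Measure G).real U.1)) := by
    rw [real_inner_comm, inner_voidVector_empty]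
  have h2 : inner ℝ (h.voidVector ∅) (h.voidVector ∅) = (1 : ℝ) := by
    rw [inner_voidVector_empty]; simp [FiniteHaarSet.coe_empty]
  have h4 := h.inner_voidVector_empty V
  have h3 := measureReal_union_add_inter (μ := (haar : Measure G)) (s := U.1) V.2.1 U.2.2 V.2.2
  simp only [expVector, inner_sub_left, inner_sub_right, real_inner_smul_left,
    real_inner_smul_right, h1, h2, h4, h.inner_voidVector U V]
  simp only [← Real.exp_add]
  rw [add_neg_cancel, add_neg_cancel, Real.exp_zero]
  have h5 : t * (haar : Measure G).real V.1 + (t * (haar : Measure G).real U.1 +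
      -(t * (haar : Measure G).real (U.1 ∪ V.1))) = t * (haar : Measure G).real (U.1 ∩ V.1) := by
    linear_combination -t * h3
  rw [h5]
  ring

/-- A function orthogonal to all void indicators has integral zero over a generating π-system, hence
over every measurable set. The whole space is included, as the void event of `∅`. -/
theorem dense_span_voidVector :
    (Submodule.span ℝ (Set.range h.voidVector)).topologicalClosure = ⊤ := by
  rw [Submodule.topologicalClosure_eq_top_iff, Submodule.eq_bot_iff]
  intro f hf
  have hf0 (U : FiniteHaarSet G) : ∫ x in {x | Disjoint (pts x) U.1}, f x ∂μ = 0 := by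
    rw [← L2.inner_indicatorConstLp_one (h.measurableSet_void U) (measure_ne_top μ _)]
    exact hf _ (Submodule.subset_span ⟨U, rfl⟩)
  have hint : Integrable f μ := (Lp.memLp f).integrable one_le_two
  have htot : ∫ x, f x ∂μ = 0 := by
    have := hf0 ∅
    simpa [FiniteHaarSet.coe_empty] using this
  have hall (s : Set X) (hs : MeasurableSet s) : ∫ x in s, f x ∂μ = 0 := by
    refine MeasurableSpace.induction_on_inter (C := fun s _ => ∫ x in s, f x ∂μ = 0)
      h.generate isPiSystem (by simp) ?_ ?_ ?_ s hs
    · rintro _ ⟨U, rfl⟩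
      exact hf0 U
    · intro s hs hs0
      have := integral_add_compl hs hint
      rwa [hs0, zero_add, htot] at this
    · intro s hd hs hs0
      rw [integral_iUnion hs hd hint.integrableOn]
      simp [hs0]
  exact (Lp.eq_zero_iff_ae_eq_zero).2
    (hint.ae_eq_zero_of_forall_setIntegral_eq_zero fun s hs _ => hall s hs)

theorem exists_linearCombination_expVector_near (f : Lp ℝ 2 μ) (hf : ∫ x, f x ∂μ = 0)
    {ε : ℝ} (hε : 0 < ε) :
    ∃ c : FiniteHaarSet G →₀ ℝ, ‖Finsupp.linearCombination ℝ h.expVector c - f‖ < ε := by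
  -- The vector of the empty set is the constant `1`, so `P` is the projection onto mean-zero
  -- functions. It fixes `f` and sends each void indicator to a multiple of an exponential vector.
  let P : Lp ℝ 2 μ →L[ℝ] Lp ℝ 2 μ := ContinuousLinearMap.id ℝ _ -
    (innerSL ℝ (h.voidVector ∅)).smulRight (h.voidVector ∅)
  have hP (x) : P x = x - inner ℝ (h.voidVector ∅) x • h.voidVector ∅ := rfl
  have hPf : P f = f := by
    rw [hP, inner_voidVector_empty_left, hf, zero_smul, sub_zero]
  have hPspan : Submodule.span ℝ (Set.range h.voidVector) ≤
      (LinearMap.range (Finsupp.linearCombination ℝ h.expVector)).comap P.toLinearMap := by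
    rw [Submodule.span_le]
    rintro _ ⟨U, rfl⟩
    refine ⟨Finsupp.single U (Real.exp (-(t * (haar : Measure G).real U.1))), ?_⟩
    rw [Finsupp.linearCombination_single]
    change _ = P _
    rw [hP, inner_voidVector_empty, expVector, smul_sub, smul_smul, ← Real.exp_add,
      neg_add_cancel, Real.exp_zero, one_smul]
  have hcl : f ∈ closure (Submodule.span ℝ (Set.range h.voidVector) : Set (Lp ℝ 2 μ)) := by
    rw [← Submodule.topologicalClosure_coe, h.dense_span_voidVector]
    trivial
  have hcl' := map_mem_closure
    (t := LinearMap.range (Finsupp.linearCombination ℝ h.expVector)) P.continuous hcl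
    fun x hx => hPspan hx
  rw [hPf] at hcl'
  obtain ⟨_, ⟨c, rfl⟩, hc⟩ := Metric.mem_closure_iff.1 hcl' ε hε
  exact ⟨c, by rwa [dist_comm, dist_eq_norm] at hc⟩

theorem expVector_translate [MeasurableConstSMul G X] [SMulInvariantMeasure G X μ]
    (g : G) (U : FiniteHaarSet G) : h.expVector (U.translate g) =
      DomMulAct.mk g⁻¹ • h.expVector U := by
  have h1 (U : FiniteHaarSet G) :
      DomMulAct.mk g⁻¹ • h.voidVector U = h.voidVector (U.translate g) := by
    rw [voidVector, mk_smul_indicatorConstLp, voidVector]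
    congr 1
    exact h.preimage_smul_void g U
  have h2 : (∅ : FiniteHaarSet G).translate g = ∅ := Subtype.ext (Set.smul_set_empty)
  rw [expVector, expVector, smul_sub, smul_comm, h1, h1, h2]
  simp [FiniteHaarSet.translate, measureReal_def, measure_smul]

end IsVoidProcess

end VoidProcess

/-! ### Spreading vectors of `L²₀` over the group -/

section VoidProcess

open Measure DomMulAct

variable {G : Type*} [Group G] [TopologicalSpace G] [IsTopologicalGroup G]
  [LocallyCompactSpace G] [MeasurableSpace G] [BorelSpace G]

/-- The kernel of the quadratic form `f ↦ ∫ F p_f`, where the density `p_f` is `f` spread over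
`G`. -/
noncomputable def spreadKernel (t : ℝ) (F : G → ℝ) (U V : FiniteHaarSet G) : ℝ :=
  t * expSubOneDiv (t * (haar : Measure G).real (U.1 ∩ V.1)) * ∫ x in U.1 ∩ V.1, F x ∂haar

theorem spreadKernel_comm (t : ℝ) (F : G → ℝ) (U V : FiniteHaarSet G) :
    spreadKernel t F U V = spreadKernel t F V U := by
  rw [spreadKernel, spreadKernel, Set.inter_comm]

theorem integrableOn_finiteHaarSet (F : Lp ℝ ∞ (haar : Measure G)) (U : FiniteHaarSet G) :
    IntegrableOn F U.1 haar :=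
  integrableOn_Lp_of_measure_ne_top F le_top U.2.2

theorem isPSDKernel_spreadKernel {t : ℝ} (ht : 0 ≤ t) {F : G → ℝ} (hF : 0 ≤ᵐ[haar] F)
    (hint : ∀ U : FiniteHaarSet G, IntegrableOn F U.1 haar) : IsPSDKernel (spreadKernel t F) :=
  ((isPSDKernel_expSubOneDiv (A := fun U : FiniteHaarSet G => U.1) (fun U => U.2.1)
    (fun U => U.2.2) ht).const_mul ht).mul_setIntegral (fun U => U.2.1) hF hint

/-- This is the Gram kernel of the exponential vectors, so it gives the densities `p_f` total mass
`‖f‖²`. -/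
theorem spreadKernel_one (t : ℝ) (U V : FiniteHaarSet G) :
    spreadKernel t (fun _ => 1) U V = Real.exp (t * (haar : Measure G).real (U.1 ∩ V.1)) - 1 := by
  rw [← mul_expSubOneDiv, spreadKernel, setIntegral_const, smul_eq_mul]
  ring

theorem spreadKernel_translate (t : ℝ) (F : G → ℝ) (g : G) (U V : FiniteHaarSet G) :
    spreadKernel t F (U.translate g) (V.translate g) = spreadKernel t (fun x => F (g * x)) U V := by
  have h1 : (U.translate g).1 ∩ (V.translate g).1 = g • (U.1 ∩ V.1) := Set.smul_set_inter.symm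
  rw [spreadKernel, spreadKernel, h1, measureReal_def, measure_smul, ← measureReal_def]
  congr 1
  have h2 := (measurePreserving_mul_left (haar : Measure G) g).setIntegral_preimage_emb
    (MeasurableEquiv.mulLeft g).measurableEmbedding F (g • (U.1 ∩ V.1))
  rw [← h2]
  congr 2
  ext x
  exact Set.smul_mem_smul_set_iff (a := g) (x := x)

theorem kernelForm_spreadKernel_add (t : ℝ) {F F' : G → ℝ}
    (hF : ∀ U : FiniteHaarSet G, IntegrableOn F U.1 haar)
    (hF' : ∀ U : FiniteHaarSet G, IntegrableOn F' U.1 haar) (c d : FiniteHaarSet G →₀ ℝ) :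
    kernelForm (spreadKernel t (fun x => F x + F' x)) c d =
      kernelForm (spreadKernel t F) c d + kernelForm (spreadKernel t F') c d := by
  rw [← kernelForm_add]
  congr 3
  ext U V
  rw [spreadKernel, spreadKernel, spreadKernel,
    integral_add ((hF U).mono_set Set.inter_subset_left) ((hF' U).mono_set Set.inter_subset_left)]
  ring

theorem kernelForm_spreadKernel_const_mul (t r : ℝ) (F : G → ℝ) (c d : FiniteHaarSet G →₀ ℝ) :
    kernelForm (spreadKernel t (fun x => r * F x)) c d = r * kernelForm (spreadKernel t F) c d := by
  rw [← kernelForm_smul]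
  congr 3
  ext U V
  rw [spreadKernel, spreadKernel, integral_const_mul]
  ring

theorem spreadKernel_congr (t : ℝ) {F F' : G → ℝ} (hF : F =ᵐ[haar] F') :
    spreadKernel t F = spreadKernel t F' := by
  ext U V
  rw [spreadKernel, spreadKernel, integral_congr_ae (ae_restrict_of_ae hF)]

namespace IsVoidProcess

variable {X : Type*} [MeasurableSpace X] [MulAction G X] {t : ℝ} {pts : X → Set G}
    {μ : Measure X} [IsProbabilityMeasure μ]

theorem kernelForm_spreadKernel_one (h : IsVoidProcess t pts μ) (c d : FiniteHaarSet G →₀ ℝ) :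
    kernelForm (spreadKernel t fun _ => 1) c d =
      inner ℝ (Finsupp.linearCombination ℝ h.expVector c)
        (Finsupp.linearCombination ℝ h.expVector d) := by
  rw [← kernelForm_inner]
  congr 3
  ext U V
  rw [spreadKernel_one, h.inner_expVector]

theorem abs_kernelForm_spreadKernel_le_of_nonneg (h : IsVoidProcess t pts μ) {F : G → ℝ}
    (hF : 0 ≤ᵐ[haar] F) (hint : ∀ U : FiniteHaarSet G, IntegrableOn F U.1 haar) {M : ℝ}
    (hM : ∀ᵐ x ∂haar, F x ≤ M) (c d : FiniteHaarSet G →₀ ℝ) :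
    |kernelForm (spreadKernel t F) c d| ≤
      M * (‖Finsupp.linearCombination ℝ h.expVector c‖ *
        ‖Finsupp.linearCombination ℝ h.expVector d‖) := by
  have hM0 : 0 ≤ M := by
    obtain ⟨x, hx, hx'⟩ := (hF.and hM).exists
    exact le_trans hx hx'
  have hself (e : FiniteHaarSet G →₀ ℝ) : kernelForm (spreadKernel t F) e e ≤
      M * ‖Finsupp.linearCombination ℝ h.expVector e‖ ^ 2 := by
    have hint' (U : FiniteHaarSet G) : IntegrableOn (fun x => -1 * F x) U.1 haar :=
      (hint U).const_mul _
    have hconst (U : FiniteHaarSet G) : IntegrableOn (fun _ : G => M * 1) U.1 haar :=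
      integrableOn_const U.2.2
    -- Positivity for `M - F`, whose form is `M` times the squared norm minus the form of `F`. The
    -- mixed bound then follows from Cauchy–Schwarz.
    have h1 : 0 ≤ kernelForm (spreadKernel t fun x => M * 1 + -1 * F x) e e := by
      refine (isPSDKernel_spreadKernel h.pos.le ?_ fun U =>
        (hconst U).add (hint' U)).kernelForm_nonneg e
      filter_upwards [hM] with x hx
      simpa using hx
    rw [kernelForm_spreadKernel_add t hconst hint', kernelForm_spreadKernel_const_mul,
      kernelForm_spreadKernel_const_mul, h.kernelForm_spreadKernel_one,
      real_inner_self_eq_norm_sq] at h1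
    linarith
  have hpsd := isPSDKernel_spreadKernel h.pos.le hF hint
  refine abs_le_of_sq_le_sq ?_ (by positivity)
  refine (hpsd.sq_kernelForm_le (spreadKernel_comm t F) c d).trans
    ((mul_le_mul (hself c) (hself d) (hpsd.kernelForm_nonneg d) (by positivity)).trans_eq (by ring))

theorem abs_kernelForm_spreadKernel_le (h : IsVoidProcess t pts μ) {F : G → ℝ}
    (hint : ∀ U : FiniteHaarSet G, IntegrableOn F U.1 haar) {M : ℝ}
    (hM : ∀ᵐ x ∂haar, |F x| ≤ M) (c d : FiniteHaarSet G →₀ ℝ) :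
    |kernelForm (spreadKernel t F) c d| ≤
      3 * M * (‖Finsupp.linearCombination ℝ h.expVector c‖ *
        ‖Finsupp.linearCombination ℝ h.expVector d‖) := by
  have hM0 : 0 ≤ M := by
    obtain ⟨x, hx⟩ := hM.exists
    exact (abs_nonneg _).trans hx
  have hconst (U : FiniteHaarSet G) : IntegrableOn (fun _ : G => M * 1) U.1 haar :=
    integrableOn_const U.2.2
  -- The shift `F + M` has values in `[0, 2M]`; undoing it costs another `M` times an inner product,
  -- whence the constant `3`.
  have h1 := h.abs_kernelForm_spreadKernel_le_of_nonneg (F := fun x => F x + M * 1)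
    (M := 2 * M) (hM.mono fun x hx => by
      change 0 ≤ F x + M * 1
      linarith [(abs_le.1 hx).1]) (fun U => (hint U).add (hconst U))
    (hM.mono fun x hx => by linarith [(abs_le.1 hx).2]) c d
  rw [kernelForm_spreadKernel_add t hint hconst, kernelForm_spreadKernel_const_mul,
    h.kernelForm_spreadKernel_one] at h1
  have h2 := abs_real_inner_le_norm (Finsupp.linearCombination ℝ h.expVector c)
    (Finsupp.linearCombination ℝ h.expVector d)
  have h3 := mul_le_mul_of_nonneg_left h2 hM0
  rw [← abs_of_nonneg hM0, ← abs_mul, abs_of_nonneg hM0] at h3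
  rw [abs_le] at *
  constructor <;> linarith [h1.1, h1.2, h3.1, h3.2]

end IsVoidProcess

end VoidProcess

/-! ### From almost invariant vectors to an invariant mean -/

section VoidProcess

open Measure DomMulAct

variable {G : Type*} [Group G] [TopologicalSpace G] [IsTopologicalGroup G]
  [LocallyCompactSpace G] [MeasurableSpace G] [BorelSpace G]

/-- A group whose action on a void process has almost invariant vectors is amenable. -/
theorem IsVoidProcess.isAmenableGroup {X : Type*} [MeasurableSpace X] [MulAction G X] {t : ℝ}
    {pts : X → Set G} {μ : Measure X} [IsProbabilityMeasure μ] [MeasurableConstSMul G X]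
    [SMulInvariantMeasure G X μ] (h : IsVoidProcess t pts μ) {f : ℕ → Lp ℝ 2 μ}
    (hf0 : ∀ n, ∫ x, f n x ∂μ = 0) (hf1 : ∀ n, ‖f n‖ = 1)
    (hf : ∀ g : G, Tendsto (fun n => ‖DomMulAct.mk g • f n - f n‖) atTop (𝓝 0)) :
    IsAmenableGroup G := by
  choose c hc using fun n : ℕ => h.exists_linearCombination_expVector_near (f n) (hf0 n)
    (Nat.one_div_pos_of_nat (α := ℝ) (n := n))
  let T := Finsupp.linearCombination ℝ h.expVector
  have hTf : Tendsto (fun n => T (c n) - f n) atTop (𝓝 0) :=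
    squeeze_zero_norm (fun n => (hc n).le) tendsto_one_div_add_atTop_nhds_zero_nat
  have hT2 (n) : ‖T (c n)‖ ≤ 2 := by
    have h1 := norm_le_norm_sub_add (T (c n)) (f n)
    have h2 : (1 : ℝ) / (n + 1) ≤ 1 :=
      (div_le_one (by positivity)).2 (by linarith [n.cast_nonneg (α := ℝ)])
    linarith [hc n, hf1 n]
  let B (F : Lp ℝ ∞ (haar : Measure G)) (n : ℕ) : ℝ :=
    kernelForm (spreadKernel t F) (c n) (c n)
  have hnorm (F : Lp ℝ ∞ (haar : Measure G)) : ∀ᵐ x ∂haar, |F x| ≤ ‖F‖ := by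
    have h1 : eLpNormEssSup F haar ≠ ∞ := by
      rw [← eLpNorm_exponent_top]
      exact Lp.eLpNorm_ne_top F
    filter_upwards [ae_le_eLpNormEssSup (f := F) (μ := haar)] with x hx
    have := ENNReal.toReal_mono h1 hx
    rwa [toReal_enorm, ← eLpNorm_exponent_top, ← Lp.norm_def] at this
  have hbdd (F : Lp ℝ ∞ (haar : Measure G)) (n : ℕ) :
      B F n ∈ Set.Icc (-(3 * ‖F‖ * (2 * 2))) (3 * ‖F‖ * (2 * 2)) := by
    refine abs_le.1 ?_
    refine (h.abs_kernelForm_spreadKernel_le (integrableOn_finiteHaarSet F)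
        (hnorm F) _ _).trans ?_
    have := hT2 n
    gcongr
  -- The values are bounded for each `F`, so they converge along a fixed free ultrafilter;
  -- uniqueness of limits makes the limit linear in `F`.
  have hlim (F : Lp ℝ ∞ (haar : Measure G)) :
      ∃ L, Tendsto (B F) (hyperfilter ℕ : Filter ℕ) (𝓝 L) := by
    obtain ⟨L, -, hL⟩ := isCompact_Icc.ultrafilter_le_nhds ((hyperfilter ℕ).map (B F))
      (le_principal_iff.2 (Eventually.of_forall (f := (hyperfilter ℕ : Filter ℕ)) (hbdd F)))
    exact ⟨L, hL⟩
  choose m hm using hlim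
  let m' : Lp ℝ ∞ (haar : Measure G) →ₗ[ℝ] ℝ :=
    { toFun := m
      map_add' F F' := by
        refine tendsto_nhds_unique (hm (F + F')) (((hm F).add (hm F')).congr fun n => ?_)
        rw [← kernelForm_spreadKernel_add t (integrableOn_finiteHaarSet F)
          (integrableOn_finiteHaarSet F')]
        exact congrArg (fun K => kernelForm K (c n) (c n))
          (spreadKernel_congr t (Lp.coeFn_add F F')).symm
      map_smul' r F := by
        refine tendsto_nhds_unique (hm (r • F)) (((hm F).const_mul r).congr fun n => ?_)
        rw [← kernelForm_spreadKernel_const_mul]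
        exact congrArg (fun K => kernelForm K (c n) (c n))
          (spreadKernel_congr t (Lp.coeFn_smul r F)).symm }
  refine ⟨m', fun F hF => ?_, ?_, fun g F => ?_⟩
  · exact ge_of_tendsto' (hm F) fun n => (isPSDKernel_spreadKernel h.pos.le
      ((Lp.coeFn_nonneg F).2 hF) (integrableOn_finiteHaarSet F)).kernelForm_nonneg _
  · refine tendsto_nhds_unique (hm _) ?_
    have h1 : Tendsto (fun n => ‖T (c n)‖ ^ 2) atTop (𝓝 1) := by
      have h2 : Tendsto (fun n => ‖T (c n)‖) atTop (𝓝 1) := by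
        rw [tendsto_iff_norm_sub_tendsto_zero]
        refine squeeze_zero (fun n => norm_nonneg _) (fun n => ?_)
          (tendsto_zero_iff_norm_tendsto_zero.1 hTf)
        rw [← hf1 n]
        exact abs_norm_sub_norm_le _ _
      simpa using h2.pow 2
    refine (h1.mono_left Nat.hyperfilter_le_atTop).congr fun n => ?_
    rw [← real_inner_self_eq_norm_sq, ← h.kernelForm_spreadKernel_one]
    change _ = kernelForm _ _ _
    rw [spreadKernel_congr t (memLp_top_const (1 : ℝ)).coeFn_toLp]
  · have hg := hf g⁻¹
    refine tendsto_nhds_unique (hm _) ?_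
    let c' (n : ℕ) := (c n).mapDomain (FiniteHaarSet.translate g)
    have hTc' (n) : T (c' n) = DomMulAct.mk g⁻¹ • T (c n) :=
      linearCombination_mapDomain_translate h.expVector_translate g (c n)
    -- The translation passes from `F` to the vector. Writing the difference of two quadratic values
    -- as the form at `(c' - c, c' + c)` then bounds it by `‖T c' - T c‖`, which tends to zero by
    -- almost invariance.
    have hB (n) : B (DomMulAct.mk g • F) n = kernelForm (spreadKernel t F) (c' n) (c' n) := by
      rw [kernelForm_mapDomain]
      simp only [spreadKernel_translate]
      change kernelForm (spreadKernel t _) _ _ = _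
      rw [spreadKernel_congr t (smul_Lp_ae_eq (DomMulAct.mk g) F)]
      rfl
    have hdiff (n) : |B (DomMulAct.mk g • F) n - B F n| ≤
        3 * ‖F‖ * (‖T (c' n) - T (c n)‖ * 4) := by
      have h1 : B (DomMulAct.mk g • F) n - B F n =
          kernelForm (spreadKernel t F) (c' n - c n) (c' n + c n) := by
        have h2 := kernelForm_comm (spreadKernel_comm t F) (c' n) (c n)
        rw [hB, map_add, map_sub, LinearMap.sub_apply, LinearMap.sub_apply, h2]
        ring
      rw [h1]
      refine (h.abs_kernelForm_spreadKernel_le (integrableOn_finiteHaarSet F)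
        (hnorm F) _ _).trans ?_
      rw [map_sub, map_add]
      have h2 : ‖T (c' n) + T (c n)‖ ≤ 4 := by
        refine (norm_add_le _ _).trans ?_
        rw [hTc', norm_smul_Lp]
        linarith [hT2 n]
      gcongr
    have hzero : Tendsto (fun n => ‖T (c' n) - T (c n)‖) atTop (𝓝 0) := by
      have h1 := (tendsto_zero_iff_norm_tendsto_zero.1 hTf)
      have h2 := (h1.add hg).add h1
      rw [add_zero, add_zero] at h2
      refine squeeze_zero (fun n => norm_nonneg _) (fun n => ?_) h2
      have h3 : T (c' n) - T (c n) = DomMulAct.mk g⁻¹ • (T (c n) - f n) +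
          (DomMulAct.mk g⁻¹ • f n - f n) - (T (c n) - f n) := by
        rw [hTc', smul_Lp_sub]
        abel
      rw [h3]
      refine (norm_sub_le _ _).trans (add_le_add_left ((norm_add_le _ _).trans ?_) _)
      rw [norm_smul_Lp]
    have hB0 : Tendsto (fun n => B (DomMulAct.mk g • F) n - B F n) atTop (𝓝 0) := by
      refine squeeze_zero_norm hdiff ?_
      simpa using (hzero.mul_const 4).const_mul (3 * ‖F‖)
    have := (hB0.mono_left Nat.hyperfilter_le_atTop).add (hm F)
    simp only [sub_add_cancel, zero_add] at this
    exact this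

end VoidProcess

/-! ### Transporting almost invariant vectors from `L²(G)` -/

section IndicatorApproximation

open Measure DomMulAct

variable {G : Type*} [Group G] [TopologicalSpace G] [IsTopologicalGroup G]
  [LocallyCompactSpace G] [MeasurableSpace G] [BorelSpace G]

/-- The indicator function of a set of finite Haar measure in `L²(G)`. -/
noncomputable def FiniteHaarSet.indicator (U : FiniteHaarSet G) : Lp ℝ 2 (haar : Measure G) :=
  indicatorConstLp 2 U.2.1 U.2.2 1

theorem FiniteHaarSet.indicator_translate (g : G) (U : FiniteHaarSet G) :
    (U.translate g).indicator = mk g⁻¹ • U.indicator := by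
  rw [indicator, indicator, mk_smul_indicatorConstLp]
  congr 1
  exact (Set.preimage_smul_inv g U.1).symm

theorem FiniteHaarSet.inner_indicator (U V : FiniteHaarSet G) :
    inner ℝ U.indicator V.indicator = (haar : Measure G).real (U.1 ∩ V.1) :=
  L2.real_inner_indicatorConstLp_one_indicatorConstLp_one _ _ _ _

theorem FiniteHaarSet.dense_span_indicator :
    (Submodule.span ℝ (Set.range (indicator (G := G)))).topologicalClosure = ⊤ := by
  rw [Submodule.topologicalClosure_eq_top_iff, Submodule.eq_bot_iff]
  intro f hf
  refine (Lp.eq_zero_iff_ae_eq_zero).2 (Lp.ae_eq_zero_of_forall_setIntegral_eq_zero f two_ne_zero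
    (by simp) (fun s hs hs' => integrableOn_Lp_of_measure_ne_top f one_le_two hs'.ne)
    fun s hs hs' => ?_)
  rw [← L2.inner_indicatorConstLp_one hs hs'.ne]
  exact hf _ (Submodule.subset_span ⟨⟨s, hs, hs'.ne⟩, rfl⟩)

theorem FiniteHaarSet.exists_linearCombination_indicator_near (f : Lp ℝ 2 (haar : Measure G))
    {ε : ℝ} (hε : 0 < ε) :
    ∃ c : FiniteHaarSet G →₀ ℝ, ‖Finsupp.linearCombination ℝ indicator c - f‖ < ε := by
  have hcl : f ∈ closure (Submodule.span ℝ (Set.range (indicator (G := G))) :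
      Set (Lp ℝ 2 (haar : Measure G))) := by
    rw [← Submodule.topologicalClosure_coe, dense_span_indicator]
    trivial
  obtain ⟨v, hv, hvf⟩ := Metric.mem_closure_iff.1 hcl ε hε
  obtain ⟨c, rfl⟩ := (Finsupp.mem_span_range_iff_exists_finsupp (R := ℝ)).1 hv
  exact ⟨c, by rwa [dist_comm, dist_eq_norm] at hvf⟩

/-- If `L²₀(X)` contains an equivariant multiple of the family of indicator functions of `L²(G)`
and `G` is amenable, then `L²₀(X)` has almost invariant vectors. -/
theorem exists_almostInvariant_of_inner_eq [SecondCountableTopology G] [T2Space G]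
    (hG : IsAmenableGroup G) {X : Type*} [MeasurableSpace X] [MulAction G X] {μ : Measure X}
    [MeasurableConstSMul G X] [SMulInvariantMeasure G X μ] [IsFiniteMeasure μ]
    {Y : FiniteHaarSet G → Lp ℝ 2 μ} (hY0 : ∀ U, ∫ x, Y U x ∂μ = 0)
    (hYg : ∀ (g : G) (U : FiniteHaarSet G), Y (U.translate g) = mk g⁻¹ • Y U) {b : ℝ} (hb : 0 < b)
    (hY : ∀ U V, inner ℝ (Y U) (Y V) = b * (haar : Measure G).real (U.1 ∩ V.1)) :
    ∃ f : ℕ → Lp ℝ 2 μ, (∀ n, ∫ x, f n x ∂μ = 0) ∧ (∀ n, ‖f n‖ = 1) ∧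
      ∀ g : G, Tendsto (fun n => ‖mk g • f n - f n‖) atTop (𝓝 0) := by
  obtain ⟨r, hr1, hr⟩ := exists_almostInvariant_L2 hG
  -- The factor `1 / 2` in the error keeps the approximants at norm at least `1 / 2`, so that they
  -- can be normalised after transport.
  choose c hc using fun n : ℕ =>
    FiniteHaarSet.exists_linearCombination_indicator_near (r n) (ε := 1 / 2 * (1 / (n + 1)))
      (by positivity)
  let S := Finsupp.linearCombination ℝ (FiniteHaarSet.indicator (G := G))
  let T := Finsupp.linearCombination ℝ Y
  -- Equal Gram kernels up to the factor `b` give an isometry up to `√b` on finite combinations;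
  -- this avoids defining a map on all of `L²(G)`.
  have hTS (d) : ‖T d‖ = √b * ‖S d‖ := by
    rw [← Real.sqrt_sq (norm_nonneg (T d)), ← real_inner_self_eq_norm_sq, ← kernelForm_inner]
    simp only [hY, ← FiniteHaarSet.inner_indicator]
    rw [kernelForm_smul, kernelForm_inner, real_inner_self_eq_norm_sq, Real.sqrt_mul hb.le,
      Real.sqrt_sq (norm_nonneg _)]
  have hT0 (d) : ∫ x, T d x ∂μ = 0 := by
    have h1 : inner ℝ (indicatorConstLp 2 .univ (measure_ne_top μ _) (1 : ℝ)) (T d) = 0 := by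
      rw [show T d = d.sum fun U a => a • Y U from rfl, Finsupp.sum, inner_sum]
      refine Finset.sum_eq_zero fun U _ => ?_
      rw [real_inner_smul_right, L2.inner_indicatorConstLp_one, setIntegral_univ, hY0, mul_zero]
    rwa [L2.inner_indicatorConstLp_one, setIntegral_univ] at h1
  have hsqrt := Real.sqrt_pos.2 hb
  have hSc (n) : 1 / 2 ≤ ‖S (c n)‖ := by
    have h1 := norm_le_norm_add_norm_sub' (r n) (S (c n))
    have h2 : (1 : ℝ) / (n + 1) ≤ 1 :=
      (div_le_one (by positivity)).2 (by linarith [n.cast_nonneg (α := ℝ)])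
    rw [norm_sub_rev] at h1
    linarith [hc n, hr1 n]
  have hTc (n) : 0 < ‖T (c n)‖ := by
    rw [hTS]
    have := hSc n
    positivity
  refine ⟨fun n => ‖T (c n)‖⁻¹ • T (c n), fun n => ?_, fun n => ?_, fun g => ?_⟩
  · have := hT0 (‖T (c n)‖⁻¹ • c n)
    rwa [map_smul] at this
  · rw [norm_smul, norm_inv, norm_norm, inv_mul_cancel₀ (hTc n).ne']
  · have hdiff (d : FiniteHaarSet G →₀ ℝ) :
        ‖mk g • T d - T d‖ = √b * ‖mk g • S d - S d‖ := by
      have h1 := linearCombination_mapDomain_translate hYg g⁻¹ d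
      have h2 := linearCombination_mapDomain_translate (X := G) (μ := haar)
        (ξ := FiniteHaarSet.indicator) FiniteHaarSet.indicator_translate g⁻¹ d
      rw [inv_inv] at h1 h2
      have h3 := hTS (d.mapDomain (FiniteHaarSet.translate g⁻¹) - d)
      rw [map_sub, map_sub] at h3
      change ‖Finsupp.linearCombination ℝ Y _ - _‖ =
        √b * ‖Finsupp.linearCombination ℝ FiniteHaarSet.indicator _ - _‖ at h3
      rwa [h1, h2] at h3
    have h1 (n) : ‖mk g • ‖T (c n)‖⁻¹ • T (c n) - ‖T (c n)‖⁻¹ • T (c n)‖ ≤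
        2 * ‖mk g • S (c n) - S (c n)‖ := by
      have h2 : mk g • ‖T (c n)‖⁻¹ • T (c n) = ‖T (c n)‖⁻¹ • mk g • T (c n) := smul_comm _ _ _
      rw [h2, ← smul_sub, norm_smul, norm_inv, norm_norm, hdiff, ← div_eq_inv_mul,
        div_le_iff₀ (hTc n), hTS]
      nlinarith [mul_nonneg hsqrt.le (norm_nonneg (mk g • S (c n) - S (c n))), hSc n]
    refine squeeze_zero (fun n => norm_nonneg _) h1 ?_
    have h2 : Tendsto (fun n => ‖S (c n) - r n‖) atTop (𝓝 0) := by
      refine squeeze_zero (fun n => norm_nonneg _) (fun n => (hc n).le) ?_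
      have := (tendsto_one_div_add_atTop_nhds_zero_nat (𝕜 := ℝ)).const_mul (1 / 2)
      rwa [mul_zero] at this
    have h3 := (((h2.add (hr g)).add h2).const_mul 2)
    simp only [add_zero, mul_zero] at h3
    refine squeeze_zero (fun n => by positivity) (fun n => ?_) h3
    have h4 : mk g • S (c n) - S (c n) = mk g • (S (c n) - r n) + (mk g • r n - r n) -
        (S (c n) - r n) := by
      rw [smul_Lp_sub]
      abel
    rw [h4]
    refine mul_le_mul_of_nonneg_left ((norm_sub_le _ _).trans
      (add_le_add_left ((norm_add_le _ _).trans ?_) _)) zero_le_two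
    rw [norm_smul_Lp]

end IndicatorApproximation

/-! ### Real and complex almost invariant sequences -/

section SpectralGap

open Measure

variable {𝕜 : Type*} [RCLike 𝕜] {G : Type*} [Group G] {X : Type*} [MeasurableSpace X]
  [MulAction G X] {μ : Measure X} [MeasurableConstSMul G X] [SMulInvariantMeasure G X μ]

theorem mk_smul_toLp_eq_koopman (g : G) {u : X → ℝ} (hu : MemLp u 2 μ) :
    ∃ hu' : MemLp (koopman g⁻¹ u) 2 μ, DomMulAct.mk g • hu.toLp u = hu'.toLp (koopman g⁻¹ u) := by
  have h1 : koopman g⁻¹ u = fun x => u (g • x) := by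
    ext x
    rw [koopman, inv_inv]
  rw [h1]
  exact ⟨_, DomMulAct.mk_smul_toLp g hu⟩

theorem norm_mk_smul_toLp_sub (g : G) {u : X → ℝ} (hu : MemLp u 2 μ) :
    ‖DomMulAct.mk g • hu.toLp u - hu.toLp u‖ = (eLpNorm (koopman g⁻¹ u - u) 2 μ).toReal := by
  obtain ⟨hu', h⟩ := mk_smul_toLp_eq_koopman g hu
  rw [h, ← MemLp.toLp_sub, Lp.norm_toLp]

omit [MeasurableConstSMul G X] [SMulInvariantMeasure G X μ] in
-- Real and imaginary parts commute with the Koopman operators and do not increase norms, and one of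
-- the two must keep at least half of the norm.
theorem IsAlmostInvariantSeq.exists_real_component [IsFiniteMeasure μ] {f : ℕ → X → 𝕜}
    (hf : IsAlmostInvariantSeq 𝕜 G μ f) (n : ℕ) :
    ∃ u : X → ℝ, MemLp u 2 μ ∧ ∫ x, u x ∂μ = 0 ∧ 1 / 2 ≤ eLpNorm u 2 μ ∧
      ∀ g : G, eLpNorm (koopman g u - u) 2 μ ≤ eLpNorm (koopman g (f n) - f n) 2 μ := by
  have hint : Integrable (f n) μ := (hf.memLp n).integrable one_le_two
  have hre := (hf.memLp n).re
  have him := (hf.memLp n).im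
  have h1 : 1 ≤ eLpNorm (fun x => RCLike.re (f n x)) 2 μ +
      eLpNorm (fun x => RCLike.im (f n x)) 2 μ := by
    rw [← hf.norm_eq_one n]
    calc eLpNorm (f n) 2 μ ≤ eLpNorm ((fun x => ‖RCLike.re (f n x)‖) +
          fun x => ‖RCLike.im (f n x)‖) 2 μ := by
          refine eLpNorm_mono_real fun x => ?_
          have h2 : ‖f n x‖ ≤ ‖((RCLike.re (f n x) : ℝ) : 𝕜)‖ +
              ‖((RCLike.im (f n x) : ℝ) : 𝕜) * RCLike.I‖ := by
            conv_lhs => rw [← RCLike.re_add_im (f n x)]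
            exact norm_add_le _ _
          refine h2.trans ?_
          have hI : ‖(RCLike.I : 𝕜)‖ ≤ 1 := by
            by_cases h0 : (RCLike.I : 𝕜) = 0
            · simp [h0]
            · exact (RCLike.norm_I_of_ne_zero h0).le
          rw [norm_mul, RCLike.norm_ofReal, RCLike.norm_ofReal]
          exact add_le_add_right (mul_le_of_le_one_right (abs_nonneg _) hI) _
      _ ≤ _ := by
          refine (eLpNorm_add_le hre.1.norm him.1.norm one_le_two).trans_eq ?_
          rw [eLpNorm_norm, eLpNorm_norm]
  have h2 : 1 / 2 ≤ eLpNorm (fun x => RCLike.re (f n x)) 2 μ ∨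
      1 / 2 ≤ eLpNorm (fun x => RCLike.im (f n x)) 2 μ := by
    by_contra! hcon
    have := ENNReal.add_lt_add hcon.1 hcon.2
    rw [ENNReal.add_halves] at this
    exact this.not_ge h1
  rcases h2 with h2 | h2
  · refine ⟨_, hre, ?_, h2, fun g => eLpNorm_mono fun x => ?_⟩
    · rw [integral_re hint, hf.mean_zero n, map_zero]
    · simp only [koopman, Pi.sub_apply, ← map_sub]
      exact RCLike.norm_re_le_norm _
  · refine ⟨_, him, ?_, h2, fun g => eLpNorm_mono fun x => ?_⟩
    · rw [integral_im hint, hf.mean_zero n, map_zero]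
    · simp only [koopman, Pi.sub_apply, ← map_sub]
      exact RCLike.norm_im_le_norm _

theorem IsAlmostInvariantSeq.exists_real [IsFiniteMeasure μ] {f : ℕ → X → 𝕜}
    (hf : IsAlmostInvariantSeq 𝕜 G μ f) :
    ∃ F : ℕ → Lp ℝ 2 μ, (∀ n, ∫ x, F n x ∂μ = 0) ∧ (∀ n, ‖F n‖ = 1) ∧
      ∀ g : G, Tendsto (fun n => ‖DomMulAct.mk g • F n - F n‖) atTop (𝓝 0) := by
  choose u hu hu0 hu1 hug using hf.exists_real_component
  let U (n : ℕ) : Lp ℝ 2 μ := (hu n).toLp (u n)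
  have hU (n) : 1 / 2 ≤ ‖U n‖ := by
    rw [Lp.norm_toLp]
    simpa using ENNReal.toReal_mono (hu n).eLpNorm_ne_top (hu1 n)
  have hU0 (n) : 0 < ‖U n‖ := lt_of_lt_of_le (by norm_num) (hU n)
  refine ⟨fun n => ‖U n‖⁻¹ • U n, fun n => ?_, fun n => ?_, fun g => ?_⟩
  · rw [integral_congr_ae (Lp.coeFn_smul _ _)]
    simp only [Pi.smul_apply]
    rw [integral_smul, integral_congr_ae (hu n).coeFn_toLp, hu0, smul_zero]
  · rw [norm_smul, norm_inv, norm_norm, inv_mul_cancel₀ (hU0 n).ne']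
  · have h1 := (ENNReal.tendsto_toReal ENNReal.zero_ne_top).comp (hf.tendsto g⁻¹)
    have h2 := h1.const_mul 2
    rw [ENNReal.toReal_zero, mul_zero] at h2
    have hev : ∀ᶠ n in atTop, eLpNorm (koopman g⁻¹ (f n) - f n) 2 μ < 1 :=
      (hf.tendsto g⁻¹).eventually_lt_const zero_lt_one
    refine squeeze_zero' (Eventually.of_forall fun n => norm_nonneg _) ?_ h2
    filter_upwards [hev] with n hn
    rw [smul_comm, ← smul_sub, norm_smul, norm_inv, norm_norm, norm_mk_smul_toLp_sub]
    refine mul_le_mul ?_ (ENNReal.toReal_mono (hn.trans ENNReal.one_lt_top).ne (hug n _))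
      ENNReal.toReal_nonneg zero_le_two
    rw [← inv_inv (2 : ℝ)]
    exact inv_anti₀ (by norm_num) (by linarith [hU n])

theorem not_hasSpectralGap_of_real {F : ℕ → Lp ℝ 2 μ} (hF0 : ∀ n, ∫ x, F n x ∂μ = 0)
    (hF1 : ∀ n, ‖F n‖ = 1)
    (hF : ∀ g : G, Tendsto (fun n => ‖DomMulAct.mk g • F n - F n‖) atTop (𝓝 0)) :
    ¬ HasSpectralGap 𝕜 G μ := by
  refine not_not_intro ⟨fun n x => (F n x : 𝕜), fun n => (Lp.memLp (F n)).ofReal, fun n => ?_,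
    fun n => ?_, fun g => ?_⟩
  · rw [integral_ofReal, hF0, RCLike.ofReal_zero]
  · rw [eLpNorm_congr_norm_ae (g := F n) (ae_of_all _ fun x => by simp), ← Lp.enorm_def,
      ← ofReal_norm, hF1, ENNReal.ofReal_one]
  · have h1 := ENNReal.tendsto_ofReal (hF g⁻¹)
    rw [ENNReal.ofReal_zero] at h1
    refine h1.congr fun n => ?_
    rw [ofReal_norm, Lp.enorm_def]
    refine eLpNorm_congr_norm_ae ?_
    filter_upwards [Lp.coeFn_sub (DomMulAct.mk g⁻¹ • F n) (F n),
      DomMulAct.smul_Lp_ae_eq (DomMulAct.mk g⁻¹) (F n)] with x h2 h3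
    rw [h2, Pi.sub_apply, Pi.sub_apply, h3]
    simp only [koopman]
    rw [← RCLike.ofReal_sub, RCLike.norm_ofReal]
    rfl

end SpectralGap

/-- Suppose that `G` acts on a void process, and that the centered functions `y U` have the
covariances of a random measure with independent values. Then `G` is nonamenable if and only if the
action has spectral gap. -/
theorem IsVoidProcess.not_isAmenableGroup_iff {𝕜 : Type*} [RCLike 𝕜] {G : Type*} [Group G]
    [TopologicalSpace G] [IsTopologicalGroup G] [LocallyCompactSpace G]
    [SecondCountableTopology G] [T2Space G] [MeasurableSpace G] [BorelSpace G]
    {X : Type*} [MeasurableSpace X] [MulAction G X] {t : ℝ}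
    {pts : X → Set G} {μ : Measure X} (h : IsVoidProcess t pts μ)
    {y : FiniteHaarSet G → X → ℝ} (hy : ∀ U, MemLp (y U) 2 μ) (hy0 : ∀ U, ∫ x, y U x ∂μ = 0)
    (hyg : ∀ (g : G) U, y (U.translate g) = koopman g (y U)) {b : ℝ} (hb : 0 < b)
    (hyy : ∀ U V, ∫ x, y U x * y V x ∂μ = b * (Measure.haar : Measure G).real (U.1 ∩ V.1)) :
    ¬ IsAmenableGroup G ↔ HasSpectralGap 𝕜 G μ := by
  have := h.isProbabilityMeasure
  have := h.measurableConstSMul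
  have := h.smulInvariantMeasure
  rw [not_iff_comm]
  refine ⟨fun hgap => ?_, fun hG => ?_⟩
  · obtain ⟨f, hf⟩ := not_not.1 hgap
    obtain ⟨F, hF0, hF1, hF⟩ := hf.exists_real
    exact h.isAmenableGroup hF0 hF1 hF
  · obtain ⟨F, hF0, hF1, hF⟩ := exists_almostInvariant_of_inner_eq hG (μ := μ)
      (Y := fun U => (hy U).toLp (y U))
      (fun U => by rw [integral_congr_ae (hy U).coeFn_toLp, hy0])
      (fun g U => by
        obtain ⟨hu', hu⟩ := mk_smul_toLp_eq_koopman g⁻¹ (hy U)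
        rw [hu]
        refine MemLp.toLp_congr _ _ (ae_of_all _ fun x => ?_)
        rw [hyg, inv_inv]) hb
      (fun U V => by
        rw [← hyy, L2.inner_def]
        refine integral_congr_ae ?_
        filter_upwards [(hy U).coeFn_toLp, (hy V).coeFn_toLp] with x h1 h2
        rw [h1, h2, mul_comm]
        rfl)
    exact not_hasSpectralGap_of_real hF0 hF1 hF

/-! ### Moments of the Poisson distribution -/

section PoissonMoments

/-- The identity `E[N a(N)] = r E[a(N + 1)]`, from `n / n! = 1 / (n - 1)!`. Applied to `a = 1` and
`a(n) = n` it gives the first two moments. -/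
theorem hasSum_poisson_mul {r : ℝ≥0} {a : ℕ → ℝ} {s : ℝ}
    (h : HasSum (fun n : ℕ => Real.exp (-r) * r ^ n / n.factorial * a (n + 1)) s) :
    HasSum (fun n : ℕ => Real.exp (-r) * r ^ n / n.factorial * (n * a n)) (r * s) := by
  rw [← hasSum_nat_add_iff' 1]
  simp only [Finset.range_one, Finset.sum_singleton, Nat.cast_zero, zero_mul, mul_zero, sub_zero]
  refine (h.mul_left (r : ℝ)).congr_fun fun n => ?_
  rw [Nat.factorial_succ]
  push_cast
  have : (n.factorial : ℝ) ≠ 0 := by exact_mod_cast n.factorial_ne_zero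
  field_simp
  ring

theorem hasSum_poisson_id (r : ℝ≥0) :
    HasSum (fun n : ℕ => Real.exp (-r) * r ^ n / n.factorial * (n : ℝ)) r := by
  have := hasSum_poisson_mul (r := r) (a := fun _ => 1) (s := 1)
    (by simpa using hasSum_one_poissonMeasure r)
  simpa using this

theorem hasSum_poisson_sq (r : ℝ≥0) :
    HasSum (fun n : ℕ => Real.exp (-r) * r ^ n / n.factorial * (n : ℝ) ^ 2) (r * (r + 1)) := by
  have h1 := (hasSum_poisson_id r).add (hasSum_one_poissonMeasure r)
  have := hasSum_poisson_mul (r := r) (a := fun n => (n : ℝ)) (s := r + 1)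
    (h1.congr_fun fun n => by push_cast; ring)
  simpa only [pow_two] using this

theorem integrable_sq_poissonMeasure (r : ℝ≥0) :
    Integrable (fun n : ℕ => (n : ℝ) ^ 2) (poissonMeasure r) := by
  rw [integrable_poissonMeasure_iff]
  simpa using (hasSum_poisson_sq r).summable

theorem integral_id_poissonMeasure (r : ℝ≥0) : ∫ n : ℕ, (n : ℝ) ∂poissonMeasure r = r := by
  rw [integral_poissonMeasure]
  exact (hasSum_poisson_id r).tsum_eq

theorem integral_sq_poissonMeasure (r : ℝ≥0) :
    ∫ n : ℕ, (n : ℝ) ^ 2 ∂poissonMeasure r = r * (r + 1) := by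
  rw [integral_poissonMeasure]
  exact (hasSum_poisson_sq r).tsum_eq

end PoissonMoments

/-! ### Void events generate the σ-algebra on configurations -/

namespace Configuration

variable {Z : Type*} [TopologicalSpace Z]

theorem count_eq_zero_iff {U : Set Z} {ω : Configuration Z} :
    count U ω = 0 ↔ Disjoint ω.1 U := by
  rw [count, Set.encard_eq_zero, Set.disjoint_iff_inter_eq_empty]

/-- Finitely many points of a Hausdorff space have disjoint basic neighbourhoods; conversely,
disjoint sets that meet `ω ∩ U` supply distinct points. As the basis is countable, the right-hand
side is a countable combination of void events. -/
theorem le_count_iff_exists_basis [T2Space Z] [SecondCountableTopology Z] {U : Set Z}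
    {ω : Configuration Z} {k : ℕ} :
    (k : ℕ∞) ≤ count U ω ↔ ∃ B : Fin k → TopologicalSpace.countableBasis Z,
      Pairwise (fun i j => Disjoint (B i).1 (B j).1) ∧ ∀ i, ¬ Disjoint ω.1 (U ∩ (B i).1) := by
  constructor
  · intro h
    obtain ⟨t, ht, htk⟩ := Set.exists_subset_encard_eq h
    have hfin : t.Finite := Set.finite_of_encard_eq_coe htk
    obtain ⟨O, hO, hd⟩ := hfin.t2_separation
    lift t to Finset Z using hfin
    rw [Set.encard_coe_eq_coe_finsetCard, Nat.cast_inj] at htk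
    let e := (t.equivFinOfCardEq htk).symm
    have hB (i : Fin k) : ∃ B : TopologicalSpace.countableBasis Z, (e i : Z) ∈ B.1 ∧
        B.1 ⊆ O (e i) := by
      obtain ⟨B, hB, hx, hs⟩ :=
        (TopologicalSpace.isBasis_countableBasis Z).exists_subset_of_mem_open
        (hO (e i)).1 (hO (e i)).2
      exact ⟨⟨B, hB⟩, hx, hs⟩
    choose B hBx hBs using hB
    refine ⟨B, fun i j hij => ?_, fun i => ?_⟩
    · exact (hd (e i).2 (e j).2 fun h => hij (e.injective (Subtype.ext h))).mono (hBs i) (hBs j)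
    · exact Set.not_disjoint_iff.2 ⟨e i, (ht (e i).2).1, (ht (e i).2).2, hBx i⟩
  · rintro ⟨B, hd, hB⟩
    choose x hxω hxU hxB using fun i => Set.not_disjoint_iff.1 (hB i)
    have hinj : Function.Injective x := fun i j hij => by
      by_contra hne
      exact Set.disjoint_left.1 (hd hne) (hxB i) (hij ▸ hxB j)
    calc (k : ℕ∞) = (Set.range x).encard := by
          rw [← Set.image_univ, hinj.encard_image]; simp
      _ ≤ count U ω := Set.encard_le_encard (by
          rintro _ ⟨i, rfl⟩
          exact ⟨hxω i, hxU i⟩)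

variable [MeasurableSpace Z]

theorem measurable_count {U : Set Z} (hU : MeasurableSet U) :
    Measurable (count U : Configuration Z → ℕ∞) := by
  rw [measurable_iff_comap_le]
  exact le_iSup₂_of_le U hU le_rfl

/-- The σ-algebra on configurations is generated by the void events of any family of Borel sets
that is closed under Borel subsets and contains an exhaustion of the space. -/
theorem measurableSpace_eq_generateFrom_void [OpensMeasurableSpace Z] [T2Space Z]
    [SecondCountableTopology Z] {p : Set Z → Prop} (hp : ∀ U, p U → MeasurableSet U)
    (hmono : ∀ U V, p U → MeasurableSet V → p (V ∩ U))
    {K : ℕ → Set Z} (hK : ∀ n, p (K n)) (hKu : ⋃ n, K n = Set.univ) :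
    (inferInstance : MeasurableSpace (Configuration Z)) =
      .generateFrom (Set.range fun U : {U // p U} => {ω | Disjoint ω.1 U.1}) := by
  refine le_antisymm (iSup₂_le fun U hU => ?_) (MeasurableSpace.generateFrom_le ?_)
  · rw [← measurable_iff_comap_le]
    set m : MeasurableSpace (Configuration Z) :=
      .generateFrom (Set.range fun U : {U // p U} => {ω | Disjoint ω.1 U.1})
    have hvoid (V : Set Z) (hV : MeasurableSet V) :
        MeasurableSet[m] {ω : Configuration Z | Disjoint ω.1 V} := by
      -- The exhaustion reaches Borel sets `V` outside the family, for instance those of infinite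
      -- measure.
      have h1 : {ω : Configuration Z | Disjoint ω.1 V} = ⋂ n, {ω | Disjoint ω.1 (V ∩ K n)} := by
        ext ω
        rw [Set.mem_iInter]
        change Disjoint ω.1 V ↔ ∀ n, Disjoint ω.1 (V ∩ K n)
        rw [← Set.disjoint_iUnion_right, ← Set.inter_iUnion, hKu, Set.inter_univ]
      rw [h1]
      exact MeasurableSet.iInter fun n => .basic _ ⟨⟨_, hmono _ _ (hK n) hV⟩, rfl⟩
    have hge (k : ℕ) : MeasurableSet[m] {ω : Configuration Z | (k : ℕ∞) ≤ count U ω} := by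
      simp only [le_count_iff_exists_basis, Set.ofPred_exists]
      have : Countable (TopologicalSpace.countableBasis Z) :=
        (TopologicalSpace.countable_countableBasis Z).to_subtype
      refine MeasurableSet.iUnion fun B => ?_
      by_cases hB : Pairwise (fun i j => Disjoint (B i).1 (B j).1)
      · simp only [hB, true_and, Set.ofPred_forall]
        exact MeasurableSet.iInter fun i => (hvoid _ (hU.inter
          (TopologicalSpace.isOpen_of_mem_countableBasis (B i).2).measurableSet)).compl
      · simp only [hB, false_and]
        exact MeasurableSet.empty
    refine measurable_to_countable' fun k => ?_
    induction k using ENat.recTopCoe with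
    | top =>
      have h1 : count U ⁻¹' {⊤} = ⋂ k : ℕ, {ω : Configuration Z | (k : ℕ∞) ≤ count U ω} := by
        ext ω
        simp only [Set.mem_preimage, Set.mem_singleton_iff, Set.mem_iInter, Set.mem_ofPred_eq]
        exact ENat.eq_top_iff_forall_ge
      rw [h1]
      exact MeasurableSet.iInter hge
    | coe k =>
      have h1 : count U ⁻¹' {(k : ℕ∞)} = {ω : Configuration Z | (k : ℕ∞) ≤ count U ω} \
          {ω | ((k + 1 : ℕ) : ℕ∞) ≤ count U ω} := by
        ext ω
        simp only [Set.mem_preimage, Set.mem_singleton_iff, Set.mem_sdiff, Set.mem_ofPred_eq,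
          Nat.cast_add, Nat.cast_one, ENat.add_one_le_iff (ENat.natCast_ne_top k), not_lt]
        rw [le_antisymm_iff, and_comm]
      rw [h1]
      exact (hge k).diff (hge (k + 1))
  · rintro _ ⟨U, rfl⟩
    have h1 : {ω : Configuration Z | Disjoint ω.1 U.1} = count U.1 ⁻¹' {0} := by
      ext ω
      exact count_eq_zero_iff.symm
    exact (congrArg MeasurableSet h1).mpr (measurable_count (hp _ U.2) (MeasurableSet.singleton 0))

end Configuration

/-! ### The Poisson point process -/

section Poisson

open Measure

namespace IsPoissonPointProcess

section

variable {Z : Type*} [TopologicalSpace Z] [MeasurableSpace Z] {lam : Measure Z} {t : ℝ≥0}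
  {μ : Measure (Configuration Z)}

theorem smul_measure {c : ℝ≥0} (h : IsPoissonPointProcess (c • lam) t μ) :
    IsPoissonPointProcess lam (t * c) μ where
  isProbabilityMeasure := h.isProbabilityMeasure
  map_count U hU := by
    rw [h.map_count U hU, Measure.smul_apply, ENNReal.smul_def, smul_eq_mul, ← mul_assoc,
      ENNReal.coe_mul]
  indep := h.indep

variable (h : IsPoissonPointProcess lam t μ)
include h

theorem map_count_of_ne_top {U : Set Z} (hU : MeasurableSet U) (hU' : lam U ≠ ∞) :
    μ.map (Configuration.count U) =
      (poissonMeasure (t * (lam U).toNNReal)).map (fun k : ℕ => (k : ℕ∞)) := by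
  rw [h.map_count U hU, poissonENat, if_neg (ENNReal.mul_ne_top ENNReal.coe_ne_top hU'),
    ENNReal.toNNReal_mul, ENNReal.toNNReal_coe]

theorem measure_void {U : Set Z} (hU : MeasurableSet U) (hU' : lam U ≠ ∞) :
    μ.real {ω | Disjoint ω.1 U} = Real.exp (-(t * lam.real U)) := by
  have h1 : {ω : Configuration Z | Disjoint ω.1 U} = Configuration.count U ⁻¹' {0} := by
    ext ω
    exact Configuration.count_eq_zero_iff.symm
  have h2 : (fun k : ℕ => (k : ℕ∞)) ⁻¹' {0} = {0} := by
    ext k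
    simp
  have h3 : μ {ω | Disjoint ω.1 U} = poissonMeasure (t * (lam U).toNNReal) {0} := by
    rw [h1, ← map_apply (Configuration.measurable_count hU) (MeasurableSet.singleton 0),
      h.map_count_of_ne_top hU hU', map_apply .of_discrete (MeasurableSet.singleton 0), h2]
  rw [measureReal_def, h3, ← measureReal_def, poissonMeasure_real_singleton]
  simp [measureReal_def, ENNReal.coe_toNNReal_eq_toReal]

theorem integrable_comp_count {U : Set Z} (hU : MeasurableSet U) (hU' : lam U ≠ ∞) {φ : ℕ → ℝ}
    (hφ : Integrable φ (poissonMeasure (t * (lam U).toNNReal))) :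
    Integrable (fun ω => φ (Configuration.count U ω).toNat) μ := by
  have h1 : Integrable (fun x : ℕ∞ => φ x.toNat) (μ.map (Configuration.count U)) := by
    rw [h.map_count_of_ne_top hU hU']
    exact (integrable_map_measure .of_discrete .of_discrete).2 hφ
  exact (integrable_map_measure .of_discrete
    (Configuration.measurable_count hU).aemeasurable).1 h1

theorem integral_comp_count {U : Set Z} (hU : MeasurableSet U) (hU' : lam U ≠ ∞) (φ : ℕ → ℝ) :
    ∫ ω, φ (Configuration.count U ω).toNat ∂μ =
      ∫ n, φ n ∂poissonMeasure (t * (lam U).toNNReal) := by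
  have h1 := integral_map (μ := μ) (Configuration.measurable_count hU).aemeasurable
    (f := fun x : ℕ∞ => φ x.toNat) .of_discrete
  rw [← h1, h.map_count_of_ne_top hU hU', integral_map .of_discrete .of_discrete]
  simp

theorem ae_count_ne_top {U : Set Z} (hU : MeasurableSet U) (hU' : lam U ≠ ∞) :
    ∀ᵐ ω ∂μ, Configuration.count U ω ≠ ⊤ := by
  have h1 : ∀ᵐ x ∂μ.map (Configuration.count U), x ≠ ⊤ := by
    rw [h.map_count_of_ne_top hU hU', ae_map_iff .of_discrete .of_discrete]
    exact ae_of_all _ fun k => ENat.natCast_ne_top k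
  exact ae_of_ae_map (Configuration.measurable_count hU).aemeasurable h1

end

end IsPoissonPointProcess

/-- The number of points in `U`, centered. -/
noncomputable def Configuration.centeredCount {Z : Type*} [TopologicalSpace Z] [MeasurableSpace Z]
    (lam : Measure Z) (t : ℝ≥0) (U : Set Z) (ω : Configuration Z) : ℝ :=
  (Configuration.count U ω).toNat - t * lam.real U

namespace IsPoissonPointProcess

open Configuration

variable {Z : Type*} [TopologicalSpace Z] [MeasurableSpace Z] {lam : Measure Z} {t : ℝ≥0}
  {μ : Measure (Configuration Z)} (h : IsPoissonPointProcess lam t μ)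
include h

theorem memLp_centeredCount {U : Set Z} (hU : MeasurableSet U) (hU' : lam U ≠ ∞) :
    MemLp (centeredCount lam t U) 2 μ := by
  have := h.isProbabilityMeasure
  have h1 : MemLp (fun ω => ((count U ω).toNat : ℝ)) 2 μ := by
    refine (memLp_two_iff_integrable_sq ?_).2
      (h.integrable_comp_count hU hU' (integrable_sq_poissonMeasure _))
    exact ((measurable_of_countable fun x : ℕ∞ => (x.toNat : ℝ)).comp
      (measurable_count hU)).aestronglyMeasurable
  exact h1.sub (memLp_const _)

theorem integral_centeredCount {U : Set Z} (hU : MeasurableSet U) (hU' : lam U ≠ ∞) :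
    ∫ ω, centeredCount lam t U ω ∂μ = 0 := by
  have := h.isProbabilityMeasure
  have h1 : Integrable (fun ω => ((count U ω).toNat : ℝ)) μ := by
    have := ((h.memLp_centeredCount hU hU').integrable one_le_two).add
      (integrable_const (t * lam.real U))
    refine this.congr (ae_of_all _ fun ω => ?_)
    simp [centeredCount]
  have h2 := h.integral_comp_count hU hU' fun n => (n : ℝ)
  rw [integral_id_poissonMeasure] at h2
  simp only [centeredCount]
  rw [integral_sub h1 (integrable_const _), h2]
  simp [measureReal_def, ENNReal.coe_toNNReal_eq_toReal]

theorem integral_centeredCount_sq {U : Set Z} (hU : MeasurableSet U) (hU' : lam U ≠ ∞) :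
    ∫ ω, centeredCount lam t U ω * centeredCount lam t U ω ∂μ = t * lam.real U := by
  have := h.isProbabilityMeasure
  set r : ℝ≥0 := t * (lam U).toNNReal with hr
  have hr' : t * lam.real U = r := by simp [hr, measureReal_def, ENNReal.coe_toNNReal_eq_toReal]
  have h1 := h.integral_comp_count hU hU' fun n => ((n : ℝ) - r) * (n - r)
  have hint := integrable_sq_poissonMeasure r
  have hint1 : Integrable (fun n : ℕ => (n : ℝ)) (poissonMeasure r) := by
    rw [integrable_poissonMeasure_iff]
    simpa using (hasSum_poisson_id r).summable
  simp only [centeredCount, hr']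
  rw [h1, ← hr]
  have h2 (n : ℕ) : ((n : ℝ) - r) * (n - r) = (n : ℝ) ^ 2 - 2 * r * n + r ^ 2 := by ring
  simp only [h2]
  have hint2 : Integrable (fun n : ℕ => (n : ℝ) ^ 2 - 2 * r * n) (poissonMeasure r) :=
    hint.sub (hint1.const_mul _)
  rw [integral_add hint2 (integrable_const _), integral_sub hint (hint1.const_mul _),
    integral_const_mul, integral_id_poissonMeasure,
    integral_sq_poissonMeasure, integral_const, probReal_univ]
  simp only [smul_eq_mul]
  ring

theorem integral_centeredCount_mul_of_disjoint {U V : Set Z} (hU : MeasurableSet U)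
    (hU' : lam U ≠ ∞) (hV : MeasurableSet V) (hd : Disjoint U V) :
    ∫ ω, centeredCount lam t U ω * centeredCount lam t V ω ∂μ = 0 := by
  have h1 : IndepFun (centeredCount lam t U) (centeredCount lam t V) μ :=
    (h.indep U V hU hV hd).comp
      (measurable_of_countable fun x : ℕ∞ => (x.toNat : ℝ) - t * lam.real U)
      (measurable_of_countable fun x : ℕ∞ => (x.toNat : ℝ) - t * lam.real V)
  have hm {W : Set Z} (hW : MeasurableSet W) : AEStronglyMeasurable (centeredCount lam t W) μ :=
    ((measurable_of_countable fun x : ℕ∞ => (x.toNat : ℝ) - t * lam.real W).comp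
      (measurable_count hW)).aestronglyMeasurable
  have h2 := h1.integral_fun_mul_eq_mul_integral (hm hU) (hm hV)
  rw [h2, h.integral_centeredCount hU hU', zero_mul]

/-- The equality is only almost everywhere: `toNat` sends `⊤` to `0`, so additivity needs both
counts to be finite. -/
theorem centeredCount_union {U V : Set Z} (hU : MeasurableSet U) (hU' : lam U ≠ ∞)
    (hV : MeasurableSet V) (hV' : lam V ≠ ∞) (hd : Disjoint U V) :
    centeredCount lam t (U ∪ V) =ᵐ[μ] centeredCount lam t U + centeredCount lam t V := by
  filter_upwards [h.ae_count_ne_top hU hU', h.ae_count_ne_top hV hV'] with ω h1 h2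
  have h3 : Configuration.count (U ∪ V) ω =
      Configuration.count U ω + Configuration.count V ω := by
    rw [Configuration.count, Set.inter_union_distrib_left, Set.encard_union_eq
      (hd.mono Set.inter_subset_right Set.inter_subset_right)]
    rfl
  rw [Pi.add_apply, centeredCount, centeredCount, centeredCount, h3, ENat.toNat_add h1 h2,
    measureReal_union hd hV hU' hV']
  push_cast
  ring

/-- Split both sets along `U ∩ V`. Of the four products, the three over disjoint sets integrate to
zero by independence, and the variance over `U ∩ V` remains. -/
theorem integral_centeredCount_mul {U V : Set Z} (hU : MeasurableSet U) (hU' : lam U ≠ ∞)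
    (hV : MeasurableSet V) (hV' : lam V ≠ ∞) :
    ∫ ω, centeredCount lam t U ω * centeredCount lam t V ω ∂μ = t * lam.real (U ∩ V) := by
  have hC := hU.inter hV
  have hC' := measure_inter_ne_top_of_left_ne_top (t := V) hU'
  have hA := hU.diff hV
  have hA' : lam (U \ V) ≠ ∞ := measure_ne_top_of_subset Set.sdiff_subset hU'
  have hB := hV.diff hU
  have hB' : lam (V \ U) ≠ ∞ := measure_ne_top_of_subset Set.sdiff_subset hV'
  have h1 := h.centeredCount_union hA hA' hC hC' Set.disjoint_sdiff_inter
  have h2 := h.centeredCount_union hB hB' (hV.inter hU) (by rwa [Set.inter_comm])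
    Set.disjoint_sdiff_inter
  rw [Set.sdiff_union_inter] at h1 h2
  rw [Set.inter_comm] at h2
  have hAB : Disjoint (U \ V) (V \ U) := disjoint_sdiff_sdiff
  have hAC : Disjoint (U \ V) (U ∩ V) := Set.disjoint_sdiff_inter
  have hCB : Disjoint (U ∩ V) (V \ U) :=
    (Set.disjoint_sdiff_left.mono_right Set.inter_subset_left).symm
  have h3 : ∀ᵐ ω ∂μ, centeredCount lam t U ω * centeredCount lam t V ω =
      (centeredCount lam t (U \ V) ω * centeredCount lam t (V \ U) ω +
        centeredCount lam t (U \ V) ω * centeredCount lam t (U ∩ V) ω) +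
      (centeredCount lam t (U ∩ V) ω * centeredCount lam t (V \ U) ω +
        centeredCount lam t (U ∩ V) ω * centeredCount lam t (U ∩ V) ω) := by
    filter_upwards [h1, h2] with ω h1 h2
    rw [h1, h2, Pi.add_apply, Pi.add_apply]
    ring
  have mA := h.memLp_centeredCount hA hA'
  have mB := h.memLp_centeredCount hB hB'
  have mC := h.memLp_centeredCount hC hC'
  have iAB : Integrable (fun ω =>
      centeredCount lam t (U \ V) ω * centeredCount lam t (V \ U) ω) μ :=
    mA.integrable_mul mB
  have iAC : Integrable (fun ω =>
      centeredCount lam t (U \ V) ω * centeredCount lam t (U ∩ V) ω) μ :=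
    mA.integrable_mul mC
  have iCB : Integrable (fun ω =>
      centeredCount lam t (U ∩ V) ω * centeredCount lam t (V \ U) ω) μ :=
    mC.integrable_mul mB
  have iCC : Integrable (fun ω =>
      centeredCount lam t (U ∩ V) ω * centeredCount lam t (U ∩ V) ω) μ :=
    mC.integrable_mul mC
  rw [integral_congr_ae h3, integral_add (iAB.fun_add iAC) (iCB.fun_add iCC),
    integral_add iAB iAC, integral_add iCB iCC,
    h.integral_centeredCount_mul_of_disjoint hA hA' hB hAB,
    h.integral_centeredCount_mul_of_disjoint hA hA' hC hAC,
    h.integral_centeredCount_mul_of_disjoint hC hC' hB hCB, h.integral_centeredCount_sq hC hC']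
  ring

end IsPoissonPointProcess

variable {G : Type*} [Group G] [TopologicalSpace G] [IsTopologicalGroup G]

theorem Configuration.coe_smul (g : G) (ω : Configuration G) : (g • ω).1 = g • ω.1 := rfl

theorem Configuration.count_smul (g : G) (U : Set G) (ω : Configuration G) :
    Configuration.count (g • U) ω = Configuration.count U (g⁻¹ • ω) := by
  rw [Configuration.count, Configuration.count, Configuration.coe_smul,
    ← Set.encard_smul_set g⁻¹, Set.smul_set_inter, inv_smul_smul]

variable [LocallyCompactSpace G] [SecondCountableTopology G] [T2Space G]
  [MeasurableSpace G] [BorelSpace G]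

theorem IsPoissonPointProcess.isVoidProcess {t : ℝ≥0} (ht : 0 < t)
    {μ : Measure (Configuration G)} (h : IsPoissonPointProcess (haar : Measure G) t μ) :
    IsVoidProcess (G := G) (X := Configuration G) t (fun ω => ω.1) μ where
  isProbabilityMeasure := h.isProbabilityMeasure
  pos := ht
  pts_smul := Configuration.coe_smul
  generate := Configuration.measurableSpace_eq_generateFrom_void
    (p := fun U => MeasurableSet U ∧ (haar : Measure G) U ≠ ∞) (fun _ hU => hU.1)
    (fun _ _ hU hV => ⟨hV.inter hU.1, measure_inter_ne_top_of_right_ne_top hU.2⟩)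
    (K := spanningSets haar)
    (fun n => ⟨measurableSet_spanningSets _ n, (measure_spanningSets_lt_top _ n).ne⟩)
    (iUnion_spanningSets _)
  measure_void U := h.measure_void U.2.1 U.2.2

theorem IsPoissonPointProcess.not_isAmenableGroup_iff {𝕜 : Type*} [RCLike 𝕜] {lam : Measure G}
    [lam.IsHaarMeasure] {t : ℝ≥0} (ht : 0 < t) {μ : Measure (Configuration G)}
    (h : IsPoissonPointProcess lam t μ) : ¬ IsAmenableGroup G ↔ HasSpectralGap 𝕜 G μ := by
  -- The given Haar measure is a positive multiple of the reference one; the factor is absorbed into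
  -- the intensity.
  rw [isMulLeftInvariant_eq_smul lam haar] at h
  have h' := h.smul_measure
  have ht' : 0 < t * haarScalarFactor lam haar :=
    mul_pos ht (haarScalarFactor_pos_of_isHaarMeasure lam haar)
  refine (IsPoissonPointProcess.isVoidProcess ht' h').not_isAmenableGroup_iff
    (y := fun U => Configuration.centeredCount haar _ U.1)
    (fun U => h'.memLp_centeredCount U.2.1 U.2.2) (fun U => h'.integral_centeredCount U.2.1 U.2.2)
    (fun g U => ?_) ht' fun U V => h'.integral_centeredCount_mul U.2.1 U.2.2 V.2.1 V.2.2
  ext ω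
  simp only [Configuration.centeredCount, koopman, FiniteHaarSet.translate,
    Configuration.count_smul, measureReal_def, measure_smul]

end Poisson

/-! ### The Bernoulli shift over a discrete group -/

section Bernoulli

open Measure unitInterval

theorem setBernoulli_univ_real_disjoint {ι : Type*} (p : I) (u : Finset ι) :
    (setBernoulli (Set.univ : Set ι) p).real {S | Disjoint S (u : Set ι)} =
      (1 - p : ℝ) ^ u.card := by
  have h1 : (fun f : ι → Prop => {i | f i}) ⁻¹' {S | Disjoint S (u : Set ι)} =
      Set.pi u fun _ => {False} := by
    ext f
    simp [Set.disjoint_right, Set.mem_pi]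
  rw [measureReal_def, setBernoulli_apply', h1, infinitePi_pi _ fun _ _ => .of_discrete]
  simp

theorem measurableSet_disjoint_singleton {ι : Type*} (x : ι) :
    MeasurableSet {S : Set ι | Disjoint S {x}} := by
  have h1 : {S : Set ι | Disjoint S {x}} = (fun S => x ∈ S) ⁻¹' {False} := by
    ext S
    simp
  rw [h1]
  exact measurable_set_mem x (MeasurableSet.singleton False)

theorem measurableSpace_set_le_generateFrom {ι : Type*} :
    (inferInstance : MeasurableSpace (Set ι)) ≤
      .generateFrom (Set.range fun x : ι => {S : Set ι | Disjoint S {x}}) := by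
  have h1 : @Measurable (Set ι) (Set ι)
      (.generateFrom (Set.range fun x : ι => {S : Set ι | Disjoint S {x}})) _ id := by
    refine @measurable_set_iff ι (Set ι) (.generateFrom _) id |>.2 fun x => ?_
    refine @measurable_to_prop (Set ι) (.generateFrom _) _ ?_
    have h2 : (fun S : Set ι => x ∈ id S) ⁻¹' {True} = {S : Set ι | Disjoint S {x}}ᶜ := by
      ext S
      simp
    rw [h2]
    exact @MeasurableSet.compl _ _ (.generateFrom _)
      (MeasurableSpace.measurableSet_generateFrom ⟨x, rfl⟩)
  exact fun A hA => h1 hA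

variable {G : Type*} [Group G] [TopologicalSpace G] [IsTopologicalGroup G]
    [LocallyCompactSpace G] [MeasurableSpace G] [BorelSpace G] [DiscreteTopology G]

theorem haar_singleton_pos : 0 < (haar : Measure G).real {1} :=
  ENNReal.toReal_pos ((isOpen_discrete {(1 : G)}).measure_pos _ ⟨1, rfl⟩).ne'
    (isCompact_singleton.measure_lt_top).ne

variable [SecondCountableTopology G]

theorem haar_real_finset (u : Finset G) :
    (haar : Measure G).real u = u.card * (haar : Measure G).real {1} := by
  have h1 (x : G) : (haar : Measure G).real {x} = (haar : Measure G).real {1} := by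
    have := measure_smul (haar : Measure G) x {1}
    rw [Set.smul_set_singleton, smul_eq_mul, mul_one] at this
    rw [measureReal_def, this, measureReal_def]
  rw [← sum_measureReal_singleton]
  simp [h1]

theorem FiniteHaarSet.finite (U : FiniteHaarSet G) : U.1.Finite := by
  by_contra hU
  refine U.2.2 (Set.Infinite.meas_eq_top hU ⟨(haar : Measure G) {1}, ?_, fun x _ => ?_⟩)
  · exact ((isOpen_discrete {(1 : G)}).measure_pos _ ⟨1, rfl⟩).ne'
  · have := measure_smul (haar : Measure G) x {1}
    rw [Set.smul_set_singleton, smul_eq_mul, mul_one] at this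
    exact this.ge

/-- The elements of a set of finite Haar measure in a discrete group. -/
noncomputable def FiniteHaarSet.toFinset (U : FiniteHaarSet G) : Finset G := U.finite.toFinset

theorem FiniteHaarSet.coe_toFinset (U : FiniteHaarSet G) : (U.toFinset : Set G) = U.1 :=
  U.finite.coe_toFinset

/-- A set of finite Haar measure is finite, of measure `|U| λ({1})`, and the intensity is chosen so
that `exp(-t λ({1})) = 1 - p`. Singletons already generate the σ-algebra. -/
theorem isVoidProcess_setBernoulli {p : I} (hp0 : 0 < p) (hp1 : p < 1) :
    IsVoidProcess (G := G) (-Real.log (1 - p) / (haar : Measure G).real {1}) id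
      (setBernoulli (Set.univ : Set G) p) := by
  have hq0 : (0 : ℝ) < 1 - p := sub_pos.2 (by exact_mod_cast hp1)
  have hq1 : (1 - p : ℝ) < 1 := sub_lt_self _ (by exact_mod_cast hp0)
  have : Countable G := TopologicalSpace.separableSpace_iff_countable.1 inferInstance
  refine ⟨inferInstance, ?_, fun _ _ => rfl, ?_, fun U => ?_⟩
  · exact div_pos (neg_pos.2 (Real.log_neg hq0 hq1)) haar_singleton_pos
  · refine le_antisymm ?_ (MeasurableSpace.generateFrom_le ?_)
    · refine measurableSpace_set_le_generateFrom.trans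
        (MeasurableSpace.generateFrom_mono ?_)
      rintro _ ⟨x, rfl⟩
      exact ⟨⟨{x}, MeasurableSet.singleton x, isCompact_singleton.measure_lt_top.ne⟩, rfl⟩
    · rintro _ ⟨U, rfl⟩
      have h1 : {S : Set G | Disjoint S U.1} = ⋂ x ∈ U.1, {S | Disjoint S {x}} := by
        ext S
        simp [Set.disjoint_right]
      change MeasurableSet {S : Set G | Disjoint S U.1}
      rw [h1]
      exact .biInter U.1.to_countable fun x _ => measurableSet_disjoint_singleton x
  · have h1 := setBernoulli_univ_real_disjoint p U.toFinset
    have h2 := haar_real_finset U.toFinset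
    rw [U.coe_toFinset] at h1 h2
    have h3 : -(-Real.log (1 - p) / (haar : Measure G).real {1} *
        (U.toFinset.card * (haar : Measure G).real {1})) =
        U.toFinset.card * Real.log (1 - p) := by
      field_simp [(haar_singleton_pos (G := G)).ne']
    simp only [id]
    rw [h1, h2, h3, Real.exp_nat_mul, Real.exp_log hq0]

/-- The centered indicator function of the event that `x` belongs to a random set which contains
`x` with probability `p`. -/
noncomputable def centeredMem {ι : Type*} (p : I) (x : ι) (S : Set ι) : ℝ :=
  (1 - p) - {S : Set ι | Disjoint S {x}}.indicator 1 S

theorem memLp_centeredMem {ι : Type*} (p : I) (x : ι) (r : ℝ≥0∞) :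
    MemLp (centeredMem p x) r (setBernoulli (Set.univ : Set ι) p) :=
  (memLp_const _).sub ((memLp_const (1 : ℝ)).indicator (measurableSet_disjoint_singleton x))

theorem integral_centeredMem {ι : Type*} (p : I) (x : ι) :
    ∫ S, centeredMem p x S ∂setBernoulli (Set.univ : Set ι) p = 0 := by
  have h1 := setBernoulli_univ_real_disjoint p {x}
  rw [Finset.coe_singleton, Finset.card_singleton, pow_one] at h1
  have h2 : Integrable ({S : Set ι | Disjoint S {x}}.indicator (1 : Set ι → ℝ))
      (setBernoulli (Set.univ : Set ι) p) :=
    (integrable_const (1 : ℝ)).indicator (measurableSet_disjoint_singleton x)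
  simp only [centeredMem]
  rw [integral_sub (integrable_const _) h2,
    integral_indicator_one (measurableSet_disjoint_singleton x), h1]
  simp

theorem integral_centeredMem_mul {ι : Type*} [DecidableEq ι] (p : I) (x y : ι) :
    ∫ S, centeredMem p x S * centeredMem p y S ∂setBernoulli (Set.univ : Set ι) p =
      if x = y then (p * (1 - p) : ℝ) else 0 := by
  have hx := measurableSet_disjoint_singleton x
  have hy := measurableSet_disjoint_singleton y
  -- The first summand integrates to zero, leaving the probability that `x` and `y` are both absent
  -- minus `(1 - p)²`.
  have h1 (S : Set ι) : centeredMem p x S * centeredMem p y S =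
      (1 - p) * centeredMem p y S - ((1 - p) * {S : Set ι | Disjoint S {x}}.indicator 1 S -
        ({S : Set ι | Disjoint S {x}} ∩ {S : Set ι | Disjoint S {y}}).indicator 1 S) := by
    rw [Set.inter_indicator_one]
    simp only [centeredMem, Pi.mul_apply]
    ring
  have h2 : {S : Set ι | Disjoint S {x}} ∩ {S : Set ι | Disjoint S {y}} =
      {S | Disjoint S (({x, y} : Finset ι) : Set ι)} := by
    ext S
    simp
  have hint1 : Integrable ({S : Set ι | Disjoint S {x}}.indicator (1 : Set ι → ℝ))
      (setBernoulli (Set.univ : Set ι) p) := (integrable_const (1 : ℝ)).indicator hx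
  have hint2 : Integrable (({S : Set ι | Disjoint S {x}} ∩
      {S : Set ι | Disjoint S {y}}).indicator (1 : Set ι → ℝ))
      (setBernoulli (Set.univ : Set ι) p) := (integrable_const (1 : ℝ)).indicator (hx.inter hy)
  have h3 := setBernoulli_univ_real_disjoint p {x}
  rw [Finset.coe_singleton, Finset.card_singleton, pow_one] at h3
  have hint3 : Integrable (fun S => (1 - p : ℝ) * {S : Set ι | Disjoint S {x}}.indicator 1 S -
      ({S : Set ι | Disjoint S {x}} ∩ {S : Set ι | Disjoint S {y}}).indicator 1 S)
      (setBernoulli (Set.univ : Set ι) p) := (hint1.const_mul _).sub hint2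
  simp_rw [h1]
  rw [integral_sub (((memLp_centeredMem p y 1).integrable le_rfl).const_mul _) hint3,
    integral_sub (hint1.const_mul _) hint2,
    integral_const_mul, integral_const_mul, integral_centeredMem, integral_indicator_one hx,
    integral_indicator_one (hx.inter hy), h2, setBernoulli_univ_real_disjoint, h3]
  split_ifs with h
  · subst h
    simp
    ring
  · rw [Finset.card_pair h]
    ring

theorem not_isAmenableGroup_iff_setBernoulli [T2Space G] {𝕜 : Type*} [RCLike 𝕜] {p : I}
    (hp0 : 0 < p) (hp1 : p < 1) :
    ¬ IsAmenableGroup G ↔ HasSpectralGap 𝕜 G (setBernoulli (Set.univ : Set G) p) := by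
  classical
  have hq0 : (0 : ℝ) < 1 - p := sub_pos.2 (by exact_mod_cast hp1)
  have hp0' : (0 : ℝ) < p := by exact_mod_cast hp0
  have hc := haar_singleton_pos (G := G)
  refine (isVoidProcess_setBernoulli hp0 hp1).not_isAmenableGroup_iff
    (y := fun U S => ∑ x ∈ U.toFinset, centeredMem p x S)
    -- Each point contributes variance `p (1 - p)` and has Haar mass `λ({1})`.
    (b := p * (1 - p) / (haar : Measure G).real {1}) (fun U => ?_) (fun U => ?_)
    (fun g U => ?_) (by positivity) fun U V => ?_
  · exact memLp_finsetSum _ fun x _ => memLp_centeredMem p x 2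
  · rw [integral_finsetSum _ fun x _ => (memLp_centeredMem p x 1).integrable le_rfl]
    simp [integral_centeredMem]
  · funext S
    have h1 : (U.translate g).toFinset = g • U.toFinset := by
      rw [← Finset.coe_inj, FiniteHaarSet.coe_toFinset, Finset.coe_smul_finset,
        FiniteHaarSet.coe_toFinset]
      rfl
    rw [h1, koopman, Finset.smul_finset_def, Finset.sum_image fun x _ y _ h => by simpa using h]
    refine Finset.sum_congr rfl fun x _ => ?_
    simp [centeredMem, Set.indicator, Set.mem_inv_smul_set_iff]
  · have h1 : ((U.toFinset ∩ V.toFinset : Finset G) : Set G) = U.1 ∩ V.1 := by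
      rw [Finset.coe_inter, U.coe_toFinset, V.coe_toFinset]
    have h2 (x z : G) : Integrable (fun S => centeredMem p x S * centeredMem p z S)
        (setBernoulli (Set.univ : Set G) p) :=
      (memLp_centeredMem p x 2).integrable_mul (memLp_centeredMem p z 2)
    simp_rw [Finset.sum_mul_sum]
    rw [integral_finsetSum _ fun x _ => integrable_finsetSum _ fun z _ => h2 x z]
    simp_rw [integral_finsetSum _ fun z _ => h2 _ z, integral_centeredMem_mul,
      Finset.sum_ite_eq, ← Finset.sum_filter, Finset.filter_mem_eq_inter]
    rw [← h1, haar_real_finset, Finset.sum_const, nsmul_eq_mul]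
    field_simp

end Bernoulli

theorem mainTheorem6 {𝕜 : Type*} [RCLike 𝕜] {G : Type*} [Group G] [TopologicalSpace G]
    [IsTopologicalGroup G] [LocallyCompactSpace G] [SecondCountableTopology G] [T2Space G]
    [MeasurableSpace G] [BorelSpace G] :
    (¬ DiscreteTopology G →
      ∀ (lam : Measure G), lam.IsHaarMeasure → ∀ t : ℝ≥0, 0 < t →
        ∀ μ : Measure (Configuration G), IsPoissonPointProcess lam t μ →
          (¬ IsAmenableGroup G ↔ HasSpectralGap 𝕜 G μ)) ∧
    (DiscreteTopology G →
      ∀ p : unitInterval, 0 < p → p < 1 →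
        (¬ IsAmenableGroup G ↔
          HasSpectralGap 𝕜 G (setBernoulli (Set.univ : Set G) p))) := by
  refine ⟨fun _ lam hlam t ht μ hμ => ?_, fun _ p hp0 hp1 => ?_⟩
  · exact hμ.not_isAmenableGroup_iff ht
  · exact not_isAmenableGroup_iff_setBernoulli hp0 hp1
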